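/- **Language.** Expressions are $e ::= n \mid x \mid \mathtt{let}\,x=e_1\,\mathtt{in}\,e_2 \mid \mathtt{ifnp}\,x\,\mathtt{then}\,e_1\,\mathtt{else}\,e_2 \mid \mathtt{let}\,x=\mathtt{mkarray}_k\,n\,\mathtt{in}\,e \mid \mathtt{let}\,x={*y}\,\mathtt{in}\,e \mid \mathtt{let}\,x=y\boxplus z\,\mathtt{in}\,e \mid \mathtt{let}\,x=f(y_1,\dots,y_n)\,\mathtt{in}\,e \mid x:=y;e \mid \mathtt{alias}(x={*y});e \mid \mathtt{alias}(x=y\boxplus z);e \mid \mathtt{assert}(\varphi);e$, up to renaming of bound variables; $\varphi$ is any formula with finitely many free integer variables, and the annotation $k\in\{\mathrm{int},\mathrm{ptr}\}$ says whether the array elements are integers or pointers. A program $\langle D,e\rangle$ consists of definitions $f\mapsto(x_1,\dots,x_n)e_f$ and an expression $e$. Values are integers and addresses $(a,i)$ with $i\in\mathbb Z$. A configuration is $\mathbf{AssertFail}$, $\mathbf{AliasFail}$, or $\langle R,H,e\rangle$ with a register file $R$ (partial map from variables to values) and a heap $H$ (partial map from addresses to values). **Reduction** ($x'$ is any variable $\notin\mathrm{dom}(R)$;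 evaluation contexts are $E::=[\,]\mid\mathtt{let}\,x=E\,\mathtt{in}\,e$; both steps and failures propagate through contexts). A $\mathtt{let}\,x=\cdots\mathtt{in}\,e$ whose right side is $n$, $y$, $*y$, $y\boxplus z$ continues with $[x'/x]e$ and $R\{x'\mapsto v\}$, where $v=n$, $R(y)$, $H(R(y))$ (when defined), $(a,i+R(z))$ for $R(y)=(a,i)$, respectively. $\mathtt{mkarray}_k\,n$ picks $a$ with $(a,0)\notin\mathrm{dom}(H)$, stores arbitrary initial values in $(a,0),\dots,(a,n-1)$ and binds $(a,0)$; the initial values are any integers if $k=\mathrm{int}$, and any elements of a fixed set $P$ of values if $k=\mathrm{ptr}$. $\mathtt{ifnp}\,x$ takes the first branch iff $R(x)\le0$. $x:=y$ updates $H$ at $R(x)\in\mathrm{dom}(H)$ to $R(y)$. $\mathtt{let}\,x=f(\vec y)\,\mathtt{in}\,e$ steps to $\mathtt{let}\,x=[\vec y/\vec x]e_f\,\mathtt{in}\,e$. $\mathtt{alias}(x={*y});e$, where $R(y)$ is an address and $R(x)$ is defined, steps to $e$ if $H(R(y))=R(x)$, and to $\mathbf{AliasFail}$ otherwise (also if $H(R(y))$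 is undefined). $\mathtt{alias}(x=y\boxplus z);e$ with $R(x)=(a_1,i_1)$, $R(y)=(a_2,i_2)$ steps to $e$ if $a_1=a_2$ and $i_1=i_2+R(z)$, and to $\mathbf{AliasFail}$ otherwise. $\mathtt{assert}(\varphi);e$ steps to $e$ if $\models[R]\varphi$ ($\varphi$ is valid after replacing variables by the integers that $R$ assigns to them), and to $\mathbf{AssertFail}$ otherwise. **Types.** $\tau::=\{\nu:\mathrm{int}\mid\varphi\}\mid(\lambda i.\tau)\,\mathbf{ref}^r$, where $r:\mathbb Z\to[0,1]\cap\mathbb Q$ may depend on integer variables. (In)equations between ownership functions without a stated assumption are required for all values of their variables. $\{\nu\mid\varphi_1\}+\{\nu\mid\varphi_2\}=\{\nu\mid\varphi_1\wedge\varphi_2\}$, and $(\lambda i.\tau_1)\mathbf{ref}^{r_1}+(\lambda i.\tau_2)\mathbf{ref}^{r_2}=(\lambda i.\tau_1+\tau_2)\mathbf{ref}^{r_1+r_2}$ (when $r_1+r_2\le1$). $\mathrm{Empty}(\tau)$: $\tau=\{\nu\mid\top\}$, or $\tau=(\lambda i.\tau')\mathbf{ref}^{0}$ with $\mathrm{Empty}(\tau')$.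 $\tau\wedge(\nu=x)$ is $\{\nu\mid\varphi\wedge\nu=x\}$ for $\tau=\{\nu\mid\varphi\}$, and $\tau$ for pointer types. A type environment $\Gamma$ is a finite map from variables to types; $[\![\Gamma]\!]$ is the conjunction of $[x/\nu]\varphi$ over $x:\{\nu\mid\varphi\}$ in $\Gamma$. Subtyping: $\Gamma\vdash\{\nu\mid\varphi_1\}\le\{\nu\mid\varphi_2\}$ iff $\models[\![\Gamma]\!]\Rightarrow\varphi_1\Rightarrow\varphi_2$; $\Gamma\vdash(\lambda i.\tau_1)\mathbf{ref}^{r_1}\le(\lambda i.\tau_2)\mathbf{ref}^{r_2}$ iff $r_1\ge r_2$ under $[\![\Gamma]\!]$ and $\Gamma\vdash\tau_1\le\tau_2$. $\approx$ is $\le$ in both directions; for a condition $\psi$ on $i$, $\psi\vdash\tau\approx\tau'$ means equivalence under the sole assumption $\psi$. $\Gamma\le\Gamma'$ iff $\Gamma\vdash\Gamma(x)\le\Gamma'(x)$ for all $x\in\mathrm{dom}(\Gamma')\subseteq\mathrm{dom}(\Gamma)$; $\Gamma,\tau\le\Gamma',\tau'$ iff $(\Gamma,x:\tau)\le(\Gamma',x:\tau')$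 for some fresh $x$. **Well-formedness.** A type is well-formed in $\Gamma$ if every free variable has an integer type in $\Gamma$ whose formula is, recursively, well-formed, and in every $(\lambda i.\tau)\mathbf{ref}^r$ inside it $\tau$ is equivalent to an empty type whenever $r(i)=0$. $\Gamma$ is well-formed if it is built by adding fresh variables one at a time with types well-formed in the environment so far. $\tau\Rightarrow\Gamma$ is well-formed if $\tau$ is well-formed in $\Gamma$ and $\Gamma$ is well-formed. A function type $\langle x_i:\tau_i\rangle\to\langle x_i:\tau_i'\mid\tau\rangle$ (distinct $x_i$) is well-formed if $x_1:\tau_1,\dots,x_n:\tau_n$ and $\tau\Rightarrow x_1:\tau_1',\dots,x_n:\tau_n'$ are. **Typing** $\Theta\mid\Gamma\vdash e:\tau\Rightarrow\Gamma'$, where $\Theta$ maps function names to function types. In every judgement $\Gamma$ and $\tau\Rightarrow\Gamma'$ must be well-formed. Variables named separately in $\Gamma[\cdot][\cdot]$ are distinct, and a $\mathtt{let}$-bound $x$ (renamed if necessary) is fresh for the environment it extends and $x\notin\mathrm{dom}(\Gamma')$. Below, "premise $\Delta$" abbreviates $\Theta\mid\Delta\vdash e:\tau\Rightarrow\Gamma'$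 for the remaining expression $e$. - $n:\{\nu\mid\nu=n\}\Rightarrow\Gamma$. If $\Gamma(x)=\tau_1+\tau_2$ then $x:\tau_1\Rightarrow\Gamma[x\leftarrow\tau_2]$. - $\mathtt{let}\,x=e_1\,\mathtt{in}\,e_2$: $\Gamma\vdash e_1:\tau_1\Rightarrow\Gamma_1$ and $\Gamma_1,x:\tau_1\vdash e_2:\tau\Rightarrow\Gamma'$. - $\mathtt{ifnp}\,x$, $\Gamma(x)=\{\nu\mid\varphi\}$: the branches have type $\tau\Rightarrow\Gamma'$ in $\Gamma[x\leftarrow\{\nu\mid\varphi\wedge\nu\le0\}]$ and $\Gamma[x\leftarrow\{\nu\mid\varphi\wedge\nu>0\}]$, respectively. - $\mathtt{mkarray}_k\,n$: premise $\Gamma,x:(\lambda i.\tau_1)\mathbf{ref}^r$, with $r=1$ on $[0,n-1]$ and $0$ elsewhere, $\mathrm{Empty}(\tau_1)$, and $\tau_1$ of kind $k$. - $\mathtt{let}\,x={*y}$, $\Gamma(y)=(\lambda i.\tau_y)\mathbf{ref}^r$, $r(0)>0$: premise $\Gamma[y\leftarrow(\lambda i.\tau_y')\mathbf{ref}^r],x:\tau_x$,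 where for some $\tau_1$: $i=0\vdash\tau_1+\tau_x\approx\tau_y$, $i=0\vdash\tau_y'\approx\tau_1\wedge(\nu=x)$, $i\ne0\vdash\tau_y'\approx\tau_y$. - $x:=y$, $\Gamma(x)=(\lambda i.\tau_x)\mathbf{ref}^r$, $\Gamma(y)=\tau_1+\tau_2$, $r(0)=1$: premise $\Gamma[x\leftarrow(\lambda i.\tau_x')\mathbf{ref}^r][y\leftarrow\tau_1]$, where $i=0\vdash\tau_x'\approx\tau_2\wedge(\nu=y)$, $i\neq0\vdash\tau_x'\approx\tau_x$. - $\mathtt{let}\,x=y\boxplus z$, $\Gamma(y)=(\lambda i.\tau_1+\tau_2)\mathbf{ref}^{r_y}$, $\Gamma(z)=\{\nu\mid\varphi\}$: premise $\Gamma[y\leftarrow(\lambda i.\tau_1)\mathbf{ref}^{r_y'}],x:(\lambda i.[(i+z)/i]\tau_2)\mathbf{ref}^{r_x}$, where $r_x(i-z)+r_y'(i)=r_y(i)$ for all $i\in\mathbb Z$. - $\mathtt{let}\,x=f(y_1,\dots,y_n)$, $\Theta(f)=\langle x_j:\tau_j\rangle\to\langle x_j:\tau_j'\mid\tau_0\rangle$,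 $\sigma=[\vec y/\vec x]$, $y_j$ pairwise distinct, $\Gamma(y_j)=\sigma\tau_j$: premise $\Gamma[y_j\leftarrow\sigma\tau_j'],x:\sigma\tau_0$. - $\mathtt{alias}(x={*y})$, $\Gamma(x)=\rho_x$ and $\Gamma(y)=(\lambda i.\rho_y)\mathbf{ref}^r$ with $\rho_x,\rho_y$ pointer types: premise $\Gamma[x\leftarrow\rho_x'][y\leftarrow(\lambda i.\rho_y')\mathbf{ref}^r]$ with pointer types $\rho_x',\rho_y'$ such that $i=0\vdash\rho_x+\rho_y\approx\rho_x'+\rho_y'$ and $i\ne0\vdash\rho_y\approx\rho_y'$. - $\mathtt{alias}(x=y\boxplus z)$, $\Gamma(x)=(\lambda i.\tau_x)\mathbf{ref}^{r_x}$, $\Gamma(y)=(\lambda i.\tau_y)\mathbf{ref}^{r_y}$, $\Gamma(z)=\{\nu\mid\varphi\}$: premise $\Gamma[x\leftarrow(\lambda i.\tau_x')\mathbf{ref}^{r_x'}][y\leftarrow(\lambda i.\tau_y')\mathbf{ref}^{r_y'}]$ with $(\lambda i.[(i-z)/i]\tau_x)\mathbf{ref}^{r_x(\cdot-z)}+(\lambda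 i.\tau_y)\mathbf{ref}^{r_y}\approx(\lambda i.[(i-z)/i]\tau_x')\mathbf{ref}^{r_x'(\cdot-z)}+(\lambda i.\tau_y')\mathbf{ref}^{r_y'}$. - $\mathtt{assert}(\varphi)$: premise $\Gamma$, where $\models[\![\Gamma]\!]\Rightarrow\varphi$ and $\varphi$ is well-formed in $\Gamma$. - Subsumption: from $\Gamma_1\vdash e:\tau_2\Rightarrow\Gamma_2$, $\Gamma\le\Gamma_1$ and $\Gamma_2,\tau_2\le\Gamma',\tau$ infer $\Gamma\vdash e:\tau\Rightarrow\Gamma'$. $\vdash\langle D,e\rangle$ holds if for some $\Theta$ with well-formed function types: $\mathrm{dom}(D)=\mathrm{dom}(\Theta)$; for every $f\mapsto(x_1,\dots,x_n)e_f$ in $D$, $\Theta(f)=\langle x_j:\tau_j\rangle\to\langle x_j:\tau_j'\mid\tau\rangle$ with $\Theta\mid x_1:\tau_1,\dots,x_n:\tau_n\vdash e_f:\tau\Rightarrow x_1:\tau_1',\dots,x_n:\tau_n'$; and $\Theta\mid\emptyset\vdash e:\tau\Rightarrow\Gamma$ for some $\tau,\Gamma$. **Theorem (Soundness).** Suppose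 $\vdash\langle D,e\rangle$. 1. For every set $P$ of initial values for pointer arrays, $\langle\emptyset,\emptyset,e\rangle\not\longrightarrow^*\mathbf{AssertFail}$. 2. The only failure that can be reached is $\mathbf{AliasFail}$, and evaluation does not get stuck: if $P$ is a nonempty set of addresses and $\langle\emptyset,\emptyset,e\rangle\longrightarrow^* C$, then $C=\mathbf{AliasFail}$, or $C=\langle R,H,v\rangle$ with $v$ a variable or an integer, or $C\longrightarrow C'$ for some $C'$. -/

import Mathlib

namespace PtrOwn

/-! ## Variables, and integer formulas and ownership functions with free variables

Names stand for program variables; `idx` are bound variables (de Bruijn indices, `0` innermost).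
In expressions the indices are the `let`-bound variables, in types they are the value variable `ν`
of an integer type and the cell-index variables `i` of the enclosing pointer types. -/

inductive Var (n : ℕ) : Type where
  | name (x : ℕ) : Var n
  | idx (k : Fin n) : Var n
  deriving DecidableEq

/-- Passing under a binder. -/
def Var.succ {n : ℕ} : Var n → Var (n + 1)
  | .name x => .name x
  | .idx k => .idx k.succ

/-- A renaming of variables, moved under a binder. -/
def Var.lift {n m : ℕ} (f : Var n → Var m) : Var (n + 1) → Var (m + 1)
  | .name x => (f (.name x)).succ
  | .idx k => Fin.cases (.idx 0) (fun j => (f (.idx j)).succ) k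

/-- Replace the innermost bound variable by the name `x`. -/
def Var.bindName {n : ℕ} (x : ℕ) : Var (n + 1) → Var n
  | .name y => .name y
  | .idx k => Fin.cases (.name x) (fun j => .idx j) k

/-- Rename the names and leave the bound variables alone. -/
def Var.mapName {n : ℕ} (σ : ℕ → ℕ) : Var n → Var n
  | .name x => .name (σ x)
  | .idx k => .idx k

/-- An object of type `α` with finitely many free integer variables: the set of its free
variables, and its value at each valuation, which depends on these variables only.
`Dep V ℤ` are integer terms, `Dep V Prop` are formulas about integers. -/
@[ext] structure Dep (V α : Type) : Type where
  fv : Finset V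
  val : (V → ℤ) → α
  congr : ∀ ρ₁ ρ₂ : V → ℤ, (∀ v ∈ fv, ρ₁ v = ρ₂ v) → val ρ₁ = val ρ₂

namespace Dep

variable {V W α : Type}

/-- A closed object. -/
def const (a : α) : Dep V α := ⟨∅, fun _ => a, fun _ _ _ => rfl⟩

/-- The variable `v` as an integer term. -/
def var (v : V) : Dep V ℤ :=
  ⟨{v}, fun ρ => ρ v, fun _ _ h => h v (Finset.mem_singleton_self v)⟩

/-- Combine two objects by a binary operation. -/
def map₂ [DecidableEq V] {β γ : Type} (op : α → β → γ) (a : Dep V α) (b : Dep V β) : Dep V γ :=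
  ⟨a.fv ∪ b.fv, fun ρ => op (a.val ρ) (b.val ρ), fun ρ₁ ρ₂ h => by
    rw [a.congr ρ₁ ρ₂ fun v hv => h v (Finset.mem_union_left _ hv),
      b.congr ρ₁ ρ₂ fun v hv => h v (Finset.mem_union_right _ hv)]⟩

/-- Conjunction of formulas. -/
def and [DecidableEq V] (φ ψ : Dep V Prop) : Dep V Prop := map₂ (fun p q => p ∧ q) φ ψ

/-- Substitution of integer terms for all variables. -/
def subst [DecidableEq W] (s : V → Dep W ℤ) (a : Dep V α) : Dep W α :=
  ⟨a.fv.biUnion fun v => (s v).fv, fun ρ => a.val fun v => (s v).val ρ, fun ρ₁ ρ₂ h =>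
    a.congr _ _ fun v hv => (s v).congr ρ₁ ρ₂ fun w hw =>
      h w (Finset.mem_biUnion.2 ⟨v, hv, hw⟩)⟩

/-- Renaming of variables. -/
def rename [DecidableEq W] (f : V → W) (a : Dep V α) : Dep W α := a.subst fun v => var (f v)

end Dep

abbrev Term (n : ℕ) : Type := Dep (Var n) ℤ

abbrev Formula (n : ℕ) : Type := Dep (Var n) Prop

/-- Ownership functions: maps from relative addresses to rationals in `[0,1]`, which may depend
on integer variables. -/
abbrev Ownership (n : ℕ) : Type := Dep (Var n) (ℤ → Set.Icc (0 : ℚ) 1)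

/-- The valuation on the outer variables. -/
def tailVal {n : ℕ} (ρ : Var (n + 1) → ℤ) : Var n → ℤ := fun v => ρ v.succ

/-- Extend a valuation by the value of a new innermost bound variable. -/
def consVal {n : ℕ} (c : ℤ) (ρ : Var n → ℤ) : Var (n + 1) → ℤ
  | .name x => ρ (.name x)
  | .idx k => Fin.cases c (fun j => ρ (.idx j)) k

/-! ## Expressions and programs -/

/-- The elements of an array are integers or pointers. -/
inductive Kind : Type where
  | int
  | ptr

/-- Expressions. The last argument of each `let` form is the body, which binds one variable. -/
inductive Exp : ℕ → Type where
  /-- `n` -/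
  | int {n : ℕ} (c : ℤ) : Exp n
  /-- `x` -/
  | var {n : ℕ} (x : Var n) : Exp n
  /-- `let _ = e₁ in e₂` -/
  | letE {n : ℕ} (e₁ : Exp n) (e₂ : Exp (n + 1)) : Exp n
  /-- `ifnp x then e₁ else e₂`: the first branch is taken when `x ≤ 0` -/
  | ifnp {n : ℕ} (x : Var n) (e₁ e₂ : Exp n) : Exp n
  /-- `let _ = mkarray len in e`, an array of elements of kind `k` -/
  | mkarray {n : ℕ} (k : Kind) (len : ℕ) (e : Exp (n + 1)) : Exp n
  /-- `let _ = *y in e` -/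
  | deref {n : ℕ} (y : Var n) (e : Exp (n + 1)) : Exp n
  /-- `let _ = y ⊞ z in e` -/
  | addPtr {n : ℕ} (y z : Var n) (e : Exp (n + 1)) : Exp n
  /-- `let _ = f(ys) in e` -/
  | call {n : ℕ} (f : ℕ) (ys : List (Var n)) (e : Exp (n + 1)) : Exp n
  /-- `x := y; e` -/
  | assign {n : ℕ} (x y : Var n) (e : Exp n) : Exp n
  /-- `alias(x = *y); e` -/
  | aliasDeref {n : ℕ} (x y : Var n) (e : Exp n) : Exp n
  /-- `alias(x = y ⊞ z); e` -/
  | aliasAddPtr {n : ℕ} (x y z : Var n) (e : Exp n) : Exp n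
  /-- `assert(φ); e` -/
  | assert {n : ℕ} (φ : Formula n) (e : Exp n) : Exp n

namespace Exp

/-- Renaming of the variables of an expression (capture avoiding, since bound variables are
indices). -/
def rename : {n m : ℕ} → (Var n → Var m) → Exp n → Exp m
  | _, _, _, .int c => .int c
  | _, _, f, .var x => .var (f x)
  | _, _, f, .letE e₁ e₂ => .letE (e₁.rename f) (e₂.rename (Var.lift f))
  | _, _, f, .ifnp x e₁ e₂ => .ifnp (f x) (e₁.rename f) (e₂.rename f)
  | _, _, f, .mkarray k len e => .mkarray k len (e.rename (Var.lift f))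
  | _, _, f, .deref y e => .deref (f y) (e.rename (Var.lift f))
  | _, _, f, .addPtr y z e => .addPtr (f y) (f z) (e.rename (Var.lift f))
  | _, _, f, .call g ys e => .call g (ys.map f) (e.rename (Var.lift f))
  | _, _, f, .assign x y e => .assign (f x) (f y) (e.rename f)
  | _, _, f, .aliasDeref x y e => .aliasDeref (f x) (f y) (e.rename f)
  | _, _, f, .aliasAddPtr x y z e => .aliasAddPtr (f x) (f y) (f z) (e.rename f)
  | _, _, f, .assert φ e => .assert (φ.rename f) (e.rename f)

/-- `[x/_]e`: the body of a `let`, with the name `x` for the bound variable. -/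
def openWith {n : ℕ} (e : Exp (n + 1)) (x : ℕ) : Exp n := e.rename (Var.bindName x)

/-- The name `x` does not occur in the expression. -/
def Fresh (x : ℕ) : {n : ℕ} → Exp n → Prop
  | _, .int _ => True
  | _, .var y => y ≠ .name x
  | _, .letE e₁ e₂ => e₁.Fresh x ∧ e₂.Fresh x
  | _, .ifnp y e₁ e₂ => y ≠ .name x ∧ e₁.Fresh x ∧ e₂.Fresh x
  | _, .mkarray _ _ e => e.Fresh x
  | _, .deref y e => y ≠ .name x ∧ e.Fresh x
  | _, .addPtr y z e => y ≠ .name x ∧ z ≠ .name x ∧ e.Fresh x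
  | _, .call _ ys e => Var.name x ∉ ys ∧ e.Fresh x
  | _, .assign y z e => y ≠ .name x ∧ z ≠ .name x ∧ e.Fresh x
  | _, .aliasDeref y z e => y ≠ .name x ∧ z ≠ .name x ∧ e.Fresh x
  | _, .aliasAddPtr y z w e => y ≠ .name x ∧ z ≠ .name x ∧ w ≠ .name x ∧ e.Fresh x
  | _, .assert φ e => Var.name x ∉ φ.fv ∧ e.Fresh x

/-- Variables and integers, the expressions at which evaluation halts. -/
inductive IsValue : Exp 0 → Prop where
  | int (c : ℤ) : IsValue (.int c)
  | var (x : Var 0) : IsValue (.var x)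

end Exp

/-- A definition `f ↦ (x₁,…,xₙ) e`, with the parameters as names in `e`. -/
structure FunDef : Type where
  params : List ℕ
  body : Exp 0

/-- The function definitions `D` of a program `⟨D, e⟩`. -/
abbrev FunDefs : Type := ℕ → Option FunDef

/-- The simultaneous substitution `[y₁/x₁]⋯[yₙ/xₙ]` on names. -/
def argSubst (xs ys : List ℕ) (x : ℕ) : ℕ := ((xs.zip ys).lookup x).getD x

/-! ## Reduction -/

/-- An address `(a, i)`: a base address and an offset. -/
abbrev Addr : Type := ℕ × ℤ

inductive Val : Type where
  | int (c : ℤ) : Val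
  | addr (p : Addr) : Val

/-- Register files. -/
abbrev Regs : Type := ℕ → Option Val

/-- Heaps. -/
abbrev Heap : Type := Addr → Option Val

inductive Config : Type where
  | run (R : Regs) (H : Heap) (e : Exp 0) : Config
  | assertFail : Config
  | aliasFail : Config

/-- `⊨ [R]φ`: the formula is valid once the variables that hold integers in `R` are replaced by
these integers. -/
def Holds (R : Regs) (φ : Formula 0) : Prop :=
  ∀ ρ : Var 0 → ℤ, (∀ x c, R x = some (.int c) → ρ (.name x) = c) → φ.val ρ

/-- The possible initial contents of a cell of a fresh array: any integer in an array of integers,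
any value from the set `P` in an array of pointers. -/
def InitVal (P : Set Val) : Kind → Val → Prop
  | .int, v => ∃ c, v = .int c
  | .ptr, v => v ∈ P

/-- The heap `H{(a,0) ↦ m 0}⋯{(a,len-1) ↦ m (len-1)}`. -/
def Heap.alloc (H : Heap) (a : ℕ) (len : ℕ) (m : ℤ → Val) : Heap := fun p =>
  if p.1 = a ∧ 0 ≤ p.2 ∧ p.2 < len then some (m p.2) else H p

/-- One reduction step of the program with definitions `D`. Evaluation contexts are
`E ::= [] | let x = E in e`; failures propagate through them. -/
inductive Step (P : Set Val) (D : FunDefs) : Config → Config → Prop where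
  | context {R H e₁ R₁ H₁ e₂} (e : Exp 1) :
      Step P D (.run R H e₁) (.run R₁ H₁ e₂) →
      Step P D (.run R H (.letE e₁ e)) (.run R₁ H₁ (.letE e₂ e))
  | contextAssertFail {R H e₁} (e : Exp 1) :
      Step P D (.run R H e₁) .assertFail →
      Step P D (.run R H (.letE e₁ e)) .assertFail
  | contextAliasFail {R H e₁} (e : Exp 1) :
      Step P D (.run R H e₁) .aliasFail →
      Step P D (.run R H (.letE e₁ e)) .aliasFail
  | letInt {R : Regs} {H c e x} :
      R x = none →
      Step P D (.run R H (.letE (.int c) e))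
        (.run (Function.update R x (some (.int c))) H (e.openWith x))
  | letVar {R : Regs} {H y e v x} :
      R y = some v → R x = none →
      Step P D (.run R H (.letE (.var (.name y)) e))
        (.run (Function.update R x (some v)) H (e.openWith x))
  | ifTrue {R : Regs} {H x e₁ e₂ c} :
      R x = some (.int c) → c ≤ 0 →
      Step P D (.run R H (.ifnp (.name x) e₁ e₂)) (.run R H e₁)
  | ifFalse {R : Regs} {H x e₁ e₂ c} :
      R x = some (.int c) → 0 < c →
      Step P D (.run R H (.ifnp (.name x) e₁ e₂)) (.run R H e₂)
  | deref {R : Regs} {H : Heap} {y e p v x} :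
      R y = some (.addr p) → H p = some v → R x = none →
      Step P D (.run R H (.deref (.name y) e))
        (.run (Function.update R x (some v)) H (e.openWith x))
  | assign {R : Regs} {H : Heap} {x y e p v} :
      R x = some (.addr p) → H p ≠ none → R y = some v →
      Step P D (.run R H (.assign (.name x) (.name y) e))
        (.run R (Function.update H p (some v)) e)
  | addPtr {R : Regs} {H y z e a i c x} :
      R y = some (.addr (a, i)) → R z = some (.int c) → R x = none →
      Step P D (.run R H (.addPtr (.name y) (.name z) e))
        (.run (Function.update R x (some (.addr (a, i + c)))) H (e.openWith x))
  | mkarray {R : Regs} {H : Heap} {k} {len : ℕ} {e a x} {m : ℤ → Val} :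
      H (a, 0) = none → R x = none → (∀ j : ℤ, 0 ≤ j → j < len → InitVal P k (m j)) →
      Step P D (.run R H (.mkarray k len e))
        (.run (Function.update R x (some (.addr (a, 0)))) (H.alloc a len m) (e.openWith x))
  | call {R H f d e} {ys : List ℕ} :
      D f = some d → d.params.length = ys.length →
      Step P D (.run R H (.call f (ys.map Var.name) e))
        (.run R H (.letE (d.body.rename (Var.mapName (argSubst d.params ys))) e))
  | aliasDeref {R : Regs} {H : Heap} {x y e p v} :
      R y = some (.addr p) → R x = some v → H p = some v →
      Step P D (.run R H (.aliasDeref (.name x) (.name y) e)) (.run R H e)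
  | aliasDerefFail {R : Regs} {H : Heap} {x y e p v} :
      R y = some (.addr p) → R x = some v → H p ≠ some v →
      Step P D (.run R H (.aliasDeref (.name x) (.name y) e)) .aliasFail
  | aliasAddPtr {R : Regs} {H x y z e a i c} :
      R x = some (.addr (a, i + c)) → R y = some (.addr (a, i)) → R z = some (.int c) →
      Step P D (.run R H (.aliasAddPtr (.name x) (.name y) (.name z) e)) (.run R H e)
  | aliasAddPtrFail {R : Regs} {H x y z e a₁ i₁ a₂ i₂ c} :
      R x = some (.addr (a₁, i₁)) → R y = some (.addr (a₂, i₂)) → R z = some (.int c) →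
      (a₁ ≠ a₂ ∨ i₁ ≠ i₂ + c) →
      Step P D (.run R H (.aliasAddPtr (.name x) (.name y) (.name z) e)) .aliasFail
  | assert {R H φ e} :
      Holds R φ → Step P D (.run R H (.assert φ e)) (.run R H e)
  | assertFail {R H φ e} :
      ¬ Holds R φ → Step P D (.run R H (.assert φ e)) .assertFail

/-- The initial configuration: empty register file and empty heap. -/
def initConfig (e : Exp 0) : Config := .run (fun _ => none) (fun _ => none) e

/-- `C` is reachable from the initial configuration of `⟨D, e⟩` by finitely many steps. -/
def Reaches (P : Set Val) (D : FunDefs) (e : Exp 0) (C : Config) : Prop :=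
  Relation.ReflTransGen (Step P D) (initConfig e) C

/-! ## Types -/

/-- Types: `int φ` is `{ν : int | φ}`, with `ν` bound in `φ`; `ref τ r` is `(λi. τ) ref^r`, with
`i` bound in `τ`. -/
inductive Ty : ℕ → Type where
  | int {n : ℕ} (φ : Formula (n + 1)) : Ty n
  | ref {n : ℕ} (τ : Ty (n + 1)) (r : Ownership n) : Ty n

/-- A substitution of integer terms for variables, moved under a binder. -/
def liftSubst {n m : ℕ} (s : Var n → Term m) : Var (n + 1) → Term (m + 1)
  | .name x => (s (.name x)).rename Var.succ
  | .idx k => Fin.cases (.var (.idx 0)) (fun j => (s (.idx j)).rename Var.succ) k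

namespace Ty

def subst : {n m : ℕ} → (Var n → Term m) → Ty n → Ty m
  | _, _, s, .int φ => .int (φ.subst (liftSubst s))
  | _, _, s, .ref τ r => .ref (τ.subst (liftSubst s)) (r.subst s)

def rename {n m : ℕ} (f : Var n → Var m) (τ : Ty n) : Ty m := τ.subst fun v => .var (f v)

/-- A type, regarded as a type that may depend on an index `i` (but does not). -/
def weaken {n : ℕ} (τ : Ty n) : Ty (n + 1) := τ.rename Var.succ

/-- `[(i+z)/i]τ`. -/
def shiftAdd (z : ℕ) (τ : Ty 1) : Ty 1 :=
  τ.subst fun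
    | .name x => .var (.name x)
    | .idx k => Dep.map₂ (fun i c => i + c) (.var (.idx k)) (.var (.name z))

/-- `[(i-z)/i]τ`. -/
def shiftSub (z : ℕ) (τ : Ty 1) : Ty 1 :=
  τ.subst fun
    | .name x => .var (.name x)
    | .idx k => Dep.map₂ (fun i c => i - c) (.var (.idx k)) (.var (.name z))

def kind {n : ℕ} : Ty n → Kind
  | .int _ => .int
  | .ref _ _ => .ptr

/-- The strengthening `τ ∧_y (y =_τ x)`: it turns `{ν : int | φ}` into `{ν : int | φ ∧ ν = x}`, and
does nothing to a pointer type, for which `y =_τ x` is `⊤`. -/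
def strengthenEq {n : ℕ} (x : ℕ) : Ty n → Ty n
  | .int φ => .int (φ.and (Dep.map₂ (fun a b => a = b) (.var (.idx 0)) (.var (.name x))))
  | .ref τ r => .ref τ r

end Ty

/-- `Empty(τ)`: no information and no ownership. -/
inductive EmptyTy : {n : ℕ} → Ty n → Prop where
  | int {n : ℕ} : EmptyTy (Ty.int (Dep.const True) : Ty n)
  | ref {n : ℕ} {τ : Ty (n + 1)} {r : Ownership n} :
      EmptyTy τ → (∀ ρ j, (r.val ρ j : ℚ) = 0) → EmptyTy (.ref τ r)

/-- `TyAdd τ₁ τ₂ τ` is `τ = τ₁ + τ₂`. -/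
inductive TyAdd : {n : ℕ} → Ty n → Ty n → Ty n → Prop where
  | int {n : ℕ} {φ₁ φ₂ : Formula (n + 1)} : TyAdd (.int φ₁) (.int φ₂) (.int (φ₁.and φ₂))
  | ref {n : ℕ} {τ₁ τ₂ τ : Ty (n + 1)} {r₁ r₂ r : Ownership n} :
      TyAdd τ₁ τ₂ τ → (∀ ρ j, (r.val ρ j : ℚ) = r₁.val ρ j + r₂.val ρ j) →
      TyAdd (.ref τ₁ r₁) (.ref τ₂ r₂) (.ref τ r)

/-- Subtyping under an assumption `Q` on the values of the variables. -/
inductive SubTy : {n : ℕ} → ((Var n → ℤ) → Prop) → Ty n → Ty n → Prop where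
  | int {n : ℕ} {Q : (Var n → ℤ) → Prop} {φ₁ φ₂ : Formula (n + 1)} :
      (∀ ρ, Q (tailVal ρ) → φ₁.val ρ → φ₂.val ρ) → SubTy Q (.int φ₁) (.int φ₂)
  | ref {n : ℕ} {Q : (Var n → ℤ) → Prop} {τ₁ τ₂ : Ty (n + 1)} {r₁ r₂ : Ownership n} :
      (∀ ρ j, Q ρ → r₂.val ρ j ≤ r₁.val ρ j) → SubTy (fun ρ => Q (tailVal ρ)) τ₁ τ₂ →
      SubTy Q (.ref τ₁ r₁) (.ref τ₂ r₂)

/-- Equivalence of types under an assumption. -/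
def TyEquiv {n : ℕ} (Q : (Var n → ℤ) → Prop) (τ₁ τ₂ : Ty n) : Prop :=
  SubTy Q τ₁ τ₂ ∧ SubTy Q τ₂ τ₁

/-! ## Type environments and well-formedness -/

/-- Type environments, as (unordered) partial maps. -/
abbrev Env : Type := ℕ → Option (Ty 0)

def Env.empty : Env := fun _ => none

/-- `Γ, x : τ` (used with `x ∉ dom Γ`) and `Γ[x ← τ]` (used with `x ∈ dom Γ`). -/
def Env.set (Γ : Env) (x : ℕ) (τ : Ty 0) : Env := Function.update Γ x (some τ)

/-- `⟦Γ⟧`, the conjunction of the formulas `[x/ν]φ` for `x : {ν : int | φ}` in `Γ`. -/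
def Env.den (Γ : Env) (ρ : Var 0 → ℤ) : Prop :=
  ∀ x φ, Γ x = some (.int φ) → φ.val (consVal (ρ (.name x)) ρ)

/-- `x` has an integer type in `Γ` whose formula is itself well-formed. -/
inductive WFName (Γ : Env) : ℕ → Prop where
  | intro {x : ℕ} {φ : Formula 1} :
      Γ x = some (.int φ) → (∀ y, Var.name y ∈ φ.fv → WFName Γ y) → WFName Γ x

/-- Well-formedness of a formula, or of an ownership function. -/
def WFDep {n : ℕ} {α : Type} (Γ : Env) (a : Dep (Var n) α) : Prop :=
  ∀ x, Var.name x ∈ a.fv → WFName Γ x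

/-- Well-formedness of types. In a pointer type, the element type must be equivalent to an
empty one at every index without ownership. -/
inductive WFTy (Γ : Env) : {n : ℕ} → Ty n → Prop where
  | int {n : ℕ} {φ : Formula (n + 1)} : WFDep Γ φ → WFTy Γ (.int φ)
  | ref {n : ℕ} {τ : Ty (n + 1)} {r : Ownership n} :
      (∃ τ₀ : Ty (n + 1), EmptyTy τ₀ ∧
        TyEquiv (fun ρ => (r.val (tailVal ρ) (ρ (.idx 0)) : ℚ) = 0) τ₀ τ) →
      WFTy Γ τ → WFDep Γ r → WFTy Γ (.ref τ r)

/-- Well-formedness of environments. -/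
inductive WFEnv : Env → Prop where
  | empty : WFEnv Env.empty
  | cons {Γ : Env} {x : ℕ} {τ : Ty 0} : Γ x = none → WFEnv Γ → WFTy Γ τ → WFEnv (Γ.set x τ)

/-- Well-formedness of `τ ⇒ Γ`. -/
def WFResult (τ : Ty 0) (Γ : Env) : Prop := WFTy Γ τ ∧ WFEnv Γ

/-- `Γ₁ ≤ Γ₂`. -/
def SubEnv (Γ₁ Γ₂ : Env) : Prop :=
  ∀ x τ₂, Γ₂ x = some τ₂ → ∃ τ₁, Γ₁ x = some τ₁ ∧ SubTy Γ₁.den τ₁ τ₂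

/-- `Γ₁, τ₁ ≤ Γ₂, τ₂`. -/
def SubResult (Γ₁ : Env) (τ₁ : Ty 0) (Γ₂ : Env) (τ₂ : Ty 0) : Prop :=
  ∃ x, Γ₁ x = none ∧ Γ₂ x = none ∧ SubEnv (Γ₁.set x τ₁) (Γ₂.set x τ₂)

/-- A parameter of a function: its name and its types before and after the call. -/
structure Param : Type where
  name : ℕ
  pre : Ty 0
  post : Ty 0

/-- Function types `⟨x₁:τ₁,…,xₙ:τₙ⟩ → ⟨x₁:τ₁',…,xₙ:τₙ' | τ⟩`. -/
structure FunTy : Type where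
  params : List Param
  ret : Ty 0

namespace FunTy

def names (F : FunTy) : List ℕ := F.params.map Param.name

/-- `x₁:τ₁,…,xₙ:τₙ`. -/
def preEnv (F : FunTy) : Env := fun x => (F.params.map fun p => (p.name, p.pre)).lookup x

/-- The environment of the parameters after the call. -/
def postEnv (F : FunTy) : Env := fun x => (F.params.map fun p => (p.name, p.post)).lookup x

def WF (F : FunTy) : Prop := F.names.Nodup ∧ WFEnv F.preEnv ∧ WFResult F.ret F.postEnv

/-- The substitution `σ = [y₁/x₁]⋯[yₙ/xₙ]` on types. -/
def inst (F : FunTy) (ys : List ℕ) (τ : Ty 0) : Ty 0 :=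
  τ.rename (Var.mapName (argSubst F.names ys))

/-- `Γ[y₁:στ₁]⋯[yₙ:στₙ]`. -/
def PreAt (F : FunTy) (ys : List ℕ) (Γ : Env) : Prop :=
  List.Forall₂ (fun (p : Param) (y : ℕ) => Γ y = some (F.inst ys p.pre)) F.params ys

/-- The environment `Γ` with `yᵢ` updated to the type `σ` of the parameter after the call. -/
def update (F : FunTy) (ys : List ℕ) (Γ : Env) : Env := fun x =>
  match (ys.zip F.params).lookup x with
  | some p => some (F.inst ys p.post)
  | none => Γ x

end FunTy

/-- Function type environments. -/
abbrev FunEnv : Type := ℕ → Option FunTy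

/-! ## Typing -/

/-- The judgement `Θ | Γ ⊢ e : τ ⇒ Γₒ` is only formed when `Γ` and `τ ⇒ Γₒ` are well-formed. -/
def WFJudgement (Γ : Env) (τ : Ty 0) (Γₒ : Env) : Prop := WFEnv Γ ∧ WFResult τ Γₒ

/-- The ownership function of a fresh array. -/
def arrayOwnership (len : ℕ) : Ownership 0 :=
  .const fun i => if 0 ≤ i ∧ i < len then ⟨1, by norm_num⟩ else ⟨0, by norm_num⟩

/-- Add `ν ≤ 0` to the formula of an integer type. -/
def andNonpos (φ : Formula 1) : Formula 1 :=
  φ.and (Dep.map₂ (fun a b => a ≤ b) (.var (.idx 0)) (.const 0))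

/-- Add `ν > 0` to the formula of an integer type. -/
def andPos (φ : Formula 1) : Formula 1 :=
  φ.and (Dep.map₂ (fun a b => a > b) (.var (.idx 0)) (.const 0))

/-- The judgement `Θ | Γ ⊢ e : τ ⇒ Γₒ`. In the `let` forms `x` is the name chosen for the bound
variable. The assumptions `i : {ν : int | ν = 0}` and `i : {ν : int | ν ≠ 0}` of type equivalences
are written as conditions on the value of the index. -/
inductive HasType (Θ : FunEnv) : Env → Exp 0 → Ty 0 → Env → Prop where
  | int {Γ : Env} {c : ℤ} {τ : Ty 0} :
      τ = .int (Dep.map₂ (fun a b => a = b) (.var (.idx 0)) (.const c)) →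
      WFJudgement Γ τ Γ →
      HasType Θ Γ (.int c) τ Γ
  | var {Γ : Env} {x : ℕ} {τ τ₁ τ₂ : Ty 0} :
      Γ x = some τ → TyAdd τ₁ τ₂ τ →
      WFJudgement Γ τ₁ (Γ.set x τ₂) →
      HasType Θ Γ (.var (.name x)) τ₁ (Γ.set x τ₂)
  | letE {Γ Γ₁ Γₒ : Env} {e₁ : Exp 0} {e₂ : Exp 1} {τ₁ τ : Ty 0} (x : ℕ) :
      HasType Θ Γ e₁ τ₁ Γ₁ →
      Γ₁ x = none → e₂.Fresh x → Γₒ x = none →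
      HasType Θ (Γ₁.set x τ₁) (e₂.openWith x) τ Γₒ →
      WFJudgement Γ τ Γₒ →
      HasType Θ Γ (.letE e₁ e₂) τ Γₒ
  | ifnp {Γ Γₒ : Env} {x : ℕ} {φ : Formula 1} {e₁ e₂ : Exp 0} {τ : Ty 0} :
      Γ x = some (.int φ) →
      HasType Θ (Γ.set x (.int (andNonpos φ))) e₁ τ Γₒ →
      HasType Θ (Γ.set x (.int (andPos φ))) e₂ τ Γₒ →
      WFJudgement Γ τ Γₒ →
      HasType Θ Γ (.ifnp (.name x) e₁ e₂) τ Γₒ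
  | mkarray {Γ Γₒ : Env} {k : Kind} {len : ℕ} {e : Exp 1} {τ₁ : Ty 1} {τ : Ty 0} (x : ℕ) :
      EmptyTy τ₁ → τ₁.kind = k →
      Γ x = none → e.Fresh x → Γₒ x = none →
      HasType Θ (Γ.set x (.ref τ₁ (arrayOwnership len))) (e.openWith x) τ Γₒ →
      WFJudgement Γ τ Γₒ →
      HasType Θ Γ (.mkarray k len e) τ Γₒ
  | deref {Γ Γₒ : Env} {y : ℕ} {e : Exp 1} {τy τy₂ τ₁ τs : Ty 1} {r : Ownership 0}
      {τx τ : Ty 0} (x : ℕ) :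
      Γ y = some (.ref τy r) →
      TyAdd τ₁ τx.weaken τs →
      TyEquiv (fun ρ => ρ (.idx 0) = 0) τs τy →
      TyEquiv (fun ρ => ρ (.idx 0) = 0) τy₂ (τ₁.strengthenEq x) →
      TyEquiv (fun ρ => ρ (.idx 0) ≠ 0) τy₂ τy →
      (∀ ρ, 0 < (r.val ρ 0 : ℚ)) →
      Γ x = none → e.Fresh x → Γₒ x = none →
      HasType Θ ((Γ.set y (.ref τy₂ r)).set x τx) (e.openWith x) τ Γₒ →
      WFJudgement Γ τ Γₒ →
      HasType Θ Γ (.deref (.name y) e) τ Γₒ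
  | assign {Γ Γₒ : Env} {x y : ℕ} {e : Exp 0} {τx τx₂ : Ty 1} {r : Ownership 0}
      {τy τ₁ τ₂ τ : Ty 0} :
      x ≠ y →
      Γ x = some (.ref τx r) → Γ y = some τy → TyAdd τ₁ τ₂ τy →
      TyEquiv (fun ρ => ρ (.idx 0) = 0) τx₂ (τ₂.weaken.strengthenEq y) →
      TyEquiv (fun ρ => ρ (.idx 0) ≠ 0) τx₂ τx →
      (∀ ρ, (r.val ρ 0 : ℚ) = 1) →
      HasType Θ ((Γ.set x (.ref τx₂ r)).set y τ₁) e τ Γₒ →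
      WFJudgement Γ τ Γₒ →
      HasType Θ Γ (.assign (.name x) (.name y) e) τ Γₒ
  | addPtr {Γ Γₒ : Env} {y z : ℕ} {e : Exp 1} {τy τ₁ τ₂ : Ty 1} {rx ry ry₂ : Ownership 0}
      {φ : Formula 1} {τ : Ty 0} (x : ℕ) :
      y ≠ z →
      Γ y = some (.ref τy ry) → TyAdd τ₁ τ₂ τy → Γ z = some (.int φ) →
      (∀ (ρ : Var 0 → ℤ) (i : ℤ),
        (rx.val ρ (i - ρ (.name z)) : ℚ) + ry₂.val ρ i = ry.val ρ i) →
      Γ x = none → e.Fresh x → Γₒ x = none →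
      HasType Θ ((Γ.set y (.ref τ₁ ry₂)).set x (.ref (τ₂.shiftAdd z) rx)) (e.openWith x) τ Γₒ →
      WFJudgement Γ τ Γₒ →
      HasType Θ Γ (.addPtr (.name y) (.name z) e) τ Γₒ
  | call {Γ Γₒ : Env} {f : ℕ} {ys : List ℕ} {e : Exp 1} {F : FunTy} {τ : Ty 0} (x : ℕ) :
      Θ f = some F → ys.Nodup → F.PreAt ys Γ →
      (F.update ys Γ) x = none → e.Fresh x → Γₒ x = none →
      HasType Θ ((F.update ys Γ).set x (F.inst ys F.ret)) (e.openWith x) τ Γₒ →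
      WFJudgement Γ τ Γₒ →
      HasType Θ Γ (.call f (ys.map Var.name) e) τ Γₒ
  | aliasDeref {Γ Γₒ : Env} {x y : ℕ} {e : Exp 0} {τx τx₂ : Ty 1} {τy τy₂ : Ty 2}
      {rx rx₂ r : Ownership 0} {ry ry₂ : Ownership 1} {τs τs₂ : Ty 1} {τ : Ty 0} :
      x ≠ y →
      Γ x = some (.ref τx rx) → Γ y = some (.ref (.ref τy ry) r) →
      TyAdd (Ty.weaken (.ref τx rx)) (.ref τy ry) τs →
      TyAdd (Ty.weaken (.ref τx₂ rx₂)) (.ref τy₂ ry₂) τs₂ →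
      TyEquiv (fun ρ => ρ (.idx 0) = 0) τs τs₂ →
      TyEquiv (fun ρ => ρ (.idx 0) ≠ 0) (.ref τy ry) (.ref τy₂ ry₂) →
      HasType Θ ((Γ.set x (.ref τx₂ rx₂)).set y (.ref (.ref τy₂ ry₂) r)) e τ Γₒ →
      WFJudgement Γ τ Γₒ →
      HasType Θ Γ (.aliasDeref (.name x) (.name y) e) τ Γₒ
  | aliasAddPtr {Γ Γₒ : Env} {x y z : ℕ} {e : Exp 0} {τx τx₂ τy τy₂ : Ty 1}
      {rx rx₂ ry ry₂ rxz rxz₂ : Ownership 0} {φ : Formula 1} {τs τs₂ τ : Ty 0} :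
      x ≠ y → x ≠ z → y ≠ z →
      Γ x = some (.ref τx rx) → Γ y = some (.ref τy ry) → Γ z = some (.int φ) →
      (∀ (ρ : Var 0 → ℤ) (i : ℤ), rxz.val ρ i = rx.val ρ (i - ρ (.name z))) →
      (∀ (ρ : Var 0 → ℤ) (i : ℤ), rxz₂.val ρ i = rx₂.val ρ (i - ρ (.name z))) →
      TyAdd (.ref (τx.shiftSub z) rxz) (.ref τy ry) τs →
      TyAdd (.ref (τx₂.shiftSub z) rxz₂) (.ref τy₂ ry₂) τs₂ →
      TyEquiv (fun _ => True) τs τs₂ →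
      HasType Θ ((Γ.set x (.ref τx₂ rx₂)).set y (.ref τy₂ ry₂)) e τ Γₒ →
      WFJudgement Γ τ Γₒ →
      HasType Θ Γ (.aliasAddPtr (.name x) (.name y) (.name z) e) τ Γₒ
  | assert {Γ Γₒ : Env} {φ : Formula 0} {e : Exp 0} {τ : Ty 0} :
      (∀ ρ, Γ.den ρ → φ.val ρ) → WFDep Γ φ →
      HasType Θ Γ e τ Γₒ →
      WFJudgement Γ τ Γₒ →
      HasType Θ Γ (.assert φ e) τ Γₒ
  | sub {Γ Γ₁ Γ₂ Γₒ : Env} {e : Exp 0} {τ₂ τ : Ty 0} :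
      SubEnv Γ Γ₁ → SubResult Γ₂ τ₂ Γₒ τ →
      HasType Θ Γ₁ e τ₂ Γ₂ →
      WFJudgement Γ τ Γₒ →
      HasType Θ Γ e τ Γₒ

/-- `Θ ⊢ D`: the same functions are defined and typed, and each body has the declared type. -/
def FunsTyped (Θ : FunEnv) (D : FunDefs) : Prop :=
  (∀ f, D f = none ↔ Θ f = none) ∧
  ∀ f d F, D f = some d → Θ f = some F →
    F.names = d.params ∧ HasType Θ F.preEnv d.body F.ret F.postEnv

/-- `⊢ ⟨D, e⟩`. -/
def ProgTyped (D : FunDefs) (e : Exp 0) : Prop :=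
  ∃ (Θ : FunEnv) (τ : Ty 0) (Γ : Env),
    FunsTyped Θ D ∧ (∀ f F, Θ f = some F → F.WF) ∧ HasType Θ Env.empty e τ Γ

end PtrOwn

/-! The proof is semantic. A type is interpreted by what a value of that type owns and by what it
guarantees, and each typing rule is shown to be valid for this reading. `Ty.own` collects, for each
address, the ownership that a value carries, including that of the data reached through its cells;
it lives in `ℝ≥0∞`, so infinite sums need no summability. `Ty.Sat` imposes refinements only at cells
of positive ownership. The invariant `Good` says that the variables hold values that satisfy their
types and that, at every address, the ownerships of all variables and of a frame `F` (what the
surrounding contexts own) add up to at most 1.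

Two facts carry the argument. The first is locality (`Ty.own_heap`, `Ty.Sat.heap`): both readings
are unaffected by heap changes outside the owned cells. An assignment needs ownership 1 of the
written cell, the bound 1 leaves nothing of that cell to anyone else, and so the write is invisible
elsewhere (`sem_assign`). The second is additivity (`TyAdd.own`, `TyAdd.sat`, `TyAdd.sat_of_sat`):
splitting a type splits its ownership and keeps its guarantees, and two views of one value can be
merged again. An `alias` command merges and splits anew once its run-time test has succeeded.
Merging relies on well-formedness, which makes element types empty where there is no ownership
(`Ty.Proper`).

`Sem` is the typing judgement in this model, with a bound on the number of steps. A halted run must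
also have preserved the registers it started with and the cells in its frame, which makes the rules
for `let` and calls compositional. Since unfolding a call costs a step, recursive functions are
handled by strong induction on the bound, with an inner induction on the derivation (`HasType.sem`).

The proposition `A` switches progress on. If it is false, a variable of pointer type may hold any
value and only assertion safety is claimed; if it is true, pointers are addresses and no
configuration is stuck. The two instances give the two halves of the theorem. -/

open scoped ENNReal

namespace PtrOwn

/-! ## Valuations -/

@[simp] theorem tailVal_consVal {n : ℕ} (c : ℤ) (ρ : Var n → ℤ) : tailVal (consVal c ρ) = ρ := by
  funext v; cases v <;> rfl

@[simp] theorem consVal_idx_zero {n : ℕ} (c : ℤ) (ρ : Var n → ℤ) :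
    consVal c ρ (.idx 0) = c := rfl

@[simp] theorem consVal_name {n : ℕ} (c : ℤ) (ρ : Var n → ℤ) (x : ℕ) :
    consVal c ρ (.name x) = ρ (.name x) := rfl

theorem consVal_succ {n : ℕ} (c : ℤ) (ρ : Var n → ℤ) (v : Var n) :
    consVal c ρ v.succ = ρ v := by cases v <;> rfl

/-- The binder case of the substitution lemmas for `own`, `Sat`, `EmptyAt` and `Proper`:
substituting in a type amounts to changing the valuation. -/
theorem liftSubst_val {n m : ℕ} (s : Var n → Term m) (c : ℤ) (ρ : Var m → ℤ) :
    (fun v => (liftSubst s v).val (consVal c ρ)) = consVal c (fun v => (s v).val ρ) := by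
  have key : ∀ t : Term m, (t.rename Var.succ).val (consVal c ρ) = t.val ρ := fun t => by
    show t.val (fun v => consVal c ρ v.succ) = _
    simp only [consVal_succ]
  funext v
  match v with
  | .name x => exact key _
  | .idx k =>
    refine Fin.cases ?_ (fun j => ?_) k
    · rfl
    · exact key _

/-- Two valuations that agree on the names in the domain of `Γ` and on the bound variables. -/
def Env.Agree (Γ : Env) {n : ℕ} (ρ₁ ρ₂ : Var n → ℤ) : Prop :=
  (∀ x, Γ x ≠ none → ρ₁ (.name x) = ρ₂ (.name x)) ∧ ∀ k, ρ₁ (.idx k) = ρ₂ (.idx k)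

theorem Env.Agree.cons {Γ : Env} {n : ℕ} {ρ₁ ρ₂ : Var n → ℤ} (h : Γ.Agree ρ₁ ρ₂) (c : ℤ) :
    Γ.Agree (consVal c ρ₁) (consVal c ρ₂) := by
  refine ⟨h.1, fun k => ?_⟩
  refine Fin.cases rfl (fun j => ?_) k
  exact h.2 j

theorem WFName.ne_none {Γ : Env} {x : ℕ} (h : WFName Γ x) : Γ x ≠ none := by
  cases h with
  | intro h _ => simp [h]

theorem WFDep.val_eq {Γ : Env} {n : ℕ} {α : Type} {a : Dep (Var n) α} (h : WFDep Γ a)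
    {ρ₁ ρ₂ : Var n → ℤ} (hρ : Γ.Agree ρ₁ ρ₂) : a.val ρ₁ = a.val ρ₂ := by
  refine a.congr _ _ fun v hv => ?_
  cases v with
  | name x => exact hρ.1 x (h x hv).ne_none
  | idx k => exact hρ.2 k

/-! ## Ownership as an extended nonnegative real -/

/-- An ownership as an element of `ℝ≥0∞`. -/
noncomputable def share (q : Set.Icc (0 : ℚ) 1) : ℝ≥0∞ := ENNReal.ofReal ((q : ℚ) : ℝ)

theorem share_add {q q₁ q₂ : Set.Icc (0 : ℚ) 1} (h : (q : ℚ) = q₁ + q₂) :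
    share q = share q₁ + share q₂ := by
  unfold share
  rw [h, ← ENNReal.ofReal_add (by exact_mod_cast q₁.2.1) (by exact_mod_cast q₂.2.1)]
  push_cast; rfl

theorem share_mono {q₁ q₂ : Set.Icc (0 : ℚ) 1} (h : q₁ ≤ q₂) : share q₁ ≤ share q₂ :=
  ENNReal.ofReal_le_ofReal (by exact_mod_cast h)

theorem share_eq_zero {q : Set.Icc (0 : ℚ) 1} (h : (q : ℚ) = 0) : share q = 0 := by
  simp [share, h]

theorem share_eq_one {q : Set.Icc (0 : ℚ) 1} (h : (q : ℚ) = 1) : share q = 1 := by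
  simp [share, h]

theorem share_le_one (q : Set.Icc (0 : ℚ) 1) : share q ≤ 1 := by
  unfold share
  rw [ENNReal.ofReal_le_one]
  exact_mod_cast q.2.2

theorem pos_of_share_ne_zero {q : Set.Icc (0 : ℚ) 1} (h : share q ≠ 0) : (0 : ℚ) < q :=
  lt_of_le_of_ne q.2.1 fun h0 => h (share_eq_zero h0.symm)

/-! ## Semantics of types -/

/-- The address at distance `j` from `b`. -/
def Addr.shift (b : Addr) (j : ℤ) : Addr := (b.1, b.2 + j)

theorem Addr.shift_shift (b : Addr) (i j : ℤ) : Addr.shift (b.shift i) j = b.shift (i + j) := by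
  simp [Addr.shift, add_assoc]

theorem Addr.shift_inj {b : Addr} {i j : ℤ} : b.shift i = b.shift j ↔ i = j := by
  simp [Addr.shift]

@[simp] theorem Addr.shift_zero (b : Addr) : b.shift 0 = b := by simp [Addr.shift]

namespace Ty

/-- The ownership of the address `p` that a value of type `τ` carries. -/
noncomputable def own (H : Heap) (p : Addr) : {n : ℕ} → Ty n → (Var n → ℤ) → Val → ℝ≥0∞
  | _, .int _, _, _ => 0
  | _, .ref _ _, _, .int _ => 0
  | _, .ref τ r, ρ, .addr b =>
    ∑' j : ℤ, ((if p = Addr.shift b j then share (r.val ρ j) else 0) +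
      (H (Addr.shift b j)).elim 0 (fun w => own H p τ (consVal j ρ) w))

/-- The value satisfies the refinements of the type, at the cells that the type owns. Under `A`,
pointers are addresses. -/
def Sat (A : Prop) (H : Heap) : {n : ℕ} → Ty n → (Var n → ℤ) → Val → Prop
  | _, .int φ, ρ, v => ∃ c, v = .int c ∧ φ.val (consVal c ρ)
  | _, .ref τ r, ρ, v => (A → ∃ b, v = .addr b) ∧ ∀ b, v = .addr b → ∀ j, (0 : ℚ) < r.val ρ j →
      ∃ w, H (Addr.shift b j) = some w ∧ Sat A H τ (consVal j ρ) w

/-- The type is equivalent to an empty type at the valuation `ρ`. -/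
def EmptyAt : {n : ℕ} → Ty n → (Var n → ℤ) → Prop
  | _, .int φ, ρ => ∀ c, φ.val (consVal c ρ)
  | _, .ref τ r, ρ => ∀ j, (r.val ρ j : ℚ) = 0 ∧ EmptyAt τ (consVal j ρ)

/-- Element types are empty at the indices without ownership. -/
def Proper : {n : ℕ} → Ty n → (Var n → ℤ) → Prop
  | _, .int _, _ => True
  | _, .ref τ r, ρ => ∀ j, ((r.val ρ j : ℚ) = 0 → EmptyAt τ (consVal j ρ)) ∧
      Proper τ (consVal j ρ)

variable {A : Prop} {H : Heap} {n : ℕ}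

@[simp] theorem own_int (p : Addr) (φ : Formula (n + 1)) (ρ : Var n → ℤ) (v : Val) :
    own H p (.int φ) ρ v = 0 := by simp [own]

@[simp] theorem own_ref_int (p : Addr) (τ : Ty (n + 1)) (r : Ownership n) (ρ : Var n → ℤ) (c : ℤ) :
    own H p (.ref τ r) ρ (.int c) = 0 := by simp [own]

theorem own_ref (p : Addr) (τ : Ty (n + 1)) (r : Ownership n) (ρ : Var n → ℤ) (b : Addr) :
    own H p (.ref τ r) ρ (.addr b) =
    ∑' j : ℤ, ((if p = b.shift j then share (r.val ρ j) else 0) +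
      (H (b.shift j)).elim 0 (fun w => own H p τ (consVal j ρ) w)) := by
  rw [own]

theorem own_subst {m : ℕ} (p : Addr) (τ : Ty n) (s : Var n → Term m) (ρ : Var m → ℤ) (v : Val) :
    own H p (τ.subst s) ρ v = own H p τ (fun x => (s x).val ρ) v := by
  induction τ generalizing m v with
  | int φ => simp [subst]
  | ref τ r ih =>
    cases v with
    | int c => simp [subst]
    | addr b =>
      simp only [subst, own_ref, ih, liftSubst_val]
      rfl

theorem sat_subst {m : ℕ} (τ : Ty n) (s : Var n → Term m) (ρ : Var m → ℤ) (v : Val) :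
    Sat A H (τ.subst s) ρ v ↔ Sat A H τ (fun x => (s x).val ρ) v := by
  induction τ generalizing m v with
  | int φ => simp only [subst, Sat, Dep.subst, liftSubst_val]
  | ref τ r ih => simp only [subst, Sat, ih, liftSubst_val]; rfl

theorem emptyAt_subst {m : ℕ} (τ : Ty n) (s : Var n → Term m) (ρ : Var m → ℤ) :
    EmptyAt (τ.subst s) ρ ↔ EmptyAt τ (fun x => (s x).val ρ) := by
  induction τ generalizing m with
  | int φ => simp only [subst, EmptyAt, Dep.subst, liftSubst_val]
  | ref τ r ih => simp only [subst, EmptyAt, ih, liftSubst_val]; rfl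

theorem proper_subst {m : ℕ} (τ : Ty n) (s : Var n → Term m) (ρ : Var m → ℤ) :
    Proper (τ.subst s) ρ ↔ Proper τ (fun x => (s x).val ρ) := by
  induction τ generalizing m with
  | int φ => simp only [subst, Proper]
  | ref τ r ih => simp only [subst, Proper, ih, emptyAt_subst, liftSubst_val]; rfl

theorem own_eq_of_agree {Γ : Env} {τ : Ty n} (h : WFTy Γ τ) {ρ₁ ρ₂ : Var n → ℤ}
    (hρ : Γ.Agree ρ₁ ρ₂) (p : Addr) (v : Val) : own H p τ ρ₁ v = own H p τ ρ₂ v := by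
  induction h generalizing v with
  | int _ => simp
  | ref _ _ hr ih =>
    cases v with
    | int c => simp
    | addr b => simp only [own_ref, hr.val_eq hρ, ih (hρ.cons _)]

theorem sat_iff_of_agree {Γ : Env} {τ : Ty n} (h : WFTy Γ τ) {ρ₁ ρ₂ : Var n → ℤ}
    (hρ : Γ.Agree ρ₁ ρ₂) (v : Val) : Sat A H τ ρ₁ v ↔ Sat A H τ ρ₂ v := by
  induction h generalizing v with
  | int h => simp only [Sat, h.val_eq (hρ.cons _)]
  | ref _ _ hr ih => simp only [Sat, hr.val_eq hρ, ih (hρ.cons _)]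

theorem EmptyAt.own_eq_zero {τ : Ty n} {ρ : Var n → ℤ} (h : EmptyAt τ ρ) (p : Addr) (v : Val) :
    own H p τ ρ v = 0 := by
  induction τ generalizing v with
  | int φ => simp
  | ref τ r ih =>
    cases v with
    | int c => simp
    | addr b =>
      rw [own_ref, ENNReal.tsum_eq_zero]
      intro j
      rw [share_eq_zero (h j).1]
      cases H (b.shift j) <;> simp [ih (h j).2]

end Ty

/-! ### Empty types, subtyping and sums of types in the model. -/

theorem EmptyTy.emptyAt {n : ℕ} {τ : Ty n} (h : EmptyTy τ) (ρ : Var n → ℤ) : τ.EmptyAt ρ := by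
  induction h with
  | int => exact fun _ => trivial
  | ref _ hr ih => exact fun j => ⟨hr ρ j, ih _⟩

/-- Ownership can only decrease along subtyping, so it is squeezed to 0, and formulas only become
weaker. Thus well-formedness in the syntax yields `Proper` in the model. -/
theorem SubTy.emptyAt {n : ℕ} {Q : (Var n → ℤ) → Prop} {τ₁ τ₂ : Ty n} (h : SubTy Q τ₁ τ₂)
    {ρ : Var n → ℤ} (hQ : Q ρ) (h₁ : τ₁.EmptyAt ρ) : τ₂.EmptyAt ρ := by
  induction h with
  | int h => exact fun c => h _ (by simpa using hQ) (h₁ c)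
  | @ref n Q τ₁ τ₂ r₁ r₂ hr _ ih =>
    intro j
    have h := Subtype.coe_le_coe.2 (hr ρ j hQ)
    exact ⟨le_antisymm (h.trans (h₁ j).1.le) (r₂.val ρ j).2.1, ih (by simpa using hQ) (h₁ j).2⟩

theorem WFTy.proper {Γ : Env} {n : ℕ} {τ : Ty n} (h : WFTy Γ τ) (ρ : Var n → ℤ) :
    τ.Proper ρ := by
  induction h with
  | int _ => trivial
  | ref he _ _ ih =>
    obtain ⟨τ₀, h₀, hs, -⟩ := he
    exact fun j => ⟨fun hj => hs.emptyAt (by simpa using hj) (h₀.emptyAt _), ih _⟩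

/-- A supertype owns fewer cells, so it constrains fewer of them, and by weaker formulas. -/
theorem SubTy.sat {A : Prop} {H : Heap} {n : ℕ} {Q : (Var n → ℤ) → Prop} {τ₁ τ₂ : Ty n}
    (h : SubTy Q τ₁ τ₂) {ρ : Var n → ℤ} (hQ : Q ρ) {v : Val} (h₁ : τ₁.Sat A H ρ v) :
    τ₂.Sat A H ρ v := by
  induction h generalizing v with
  | int h =>
    obtain ⟨c, rfl, hc⟩ := h₁
    exact ⟨c, rfl, h _ (by simpa using hQ) hc⟩
  | ref hr _ ih =>
    refine ⟨h₁.1, fun b hb j hj => ?_⟩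
    obtain ⟨w, hw, hs⟩ := h₁.2 b hb j (hj.trans_le (by exact_mod_cast hr ρ j hQ))
    exact ⟨w, hw, ih (by simpa using hQ) hs⟩

theorem SubTy.own_le {H : Heap} {n : ℕ} {Q : (Var n → ℤ) → Prop} {τ₁ τ₂ : Ty n}
    (h : SubTy Q τ₁ τ₂) {ρ : Var n → ℤ} (hQ : Q ρ) (p : Addr) (v : Val) :
    τ₂.own H p ρ v ≤ τ₁.own H p ρ v := by
  induction h generalizing v with
  | int h => simp
  | ref hr _ ih =>
    cases v with
    | int c => simp
    | addr b =>
      rw [Ty.own_ref, Ty.own_ref]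
      refine ENNReal.tsum_le_tsum fun j => add_le_add ?_ ?_
      · split_ifs
        · exact share_mono (hr ρ j hQ)
        · exact le_rfl
      · cases H (b.shift j) with
        | none => simp
        | some w => exact ih (by simpa using hQ) w

theorem TyEquiv.own_eq {H : Heap} {n : ℕ} {Q : (Var n → ℤ) → Prop} {τ₁ τ₂ : Ty n}
    (h : TyEquiv Q τ₁ τ₂) {ρ : Var n → ℤ} (hQ : Q ρ) (p : Addr) (v : Val) :
    τ₁.own H p ρ v = τ₂.own H p ρ v :=
  le_antisymm (h.2.own_le hQ p v) (h.1.own_le hQ p v)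

/-- Ownership is conserved exactly, at the nested levels too, because the two element types see the
same cell contents. -/
theorem TyAdd.own {H : Heap} {n : ℕ} {τ₁ τ₂ τ : Ty n} (h : TyAdd τ₁ τ₂ τ) (ρ : Var n → ℤ)
    (p : Addr) (v : Val) : τ.own H p ρ v = τ₁.own H p ρ v + τ₂.own H p ρ v := by
  induction h generalizing v with
  | int => simp
  | ref _ hr ih =>
    cases v with
    | int c => simp
    | addr b =>
      simp only [Ty.own_ref]
      rw [← ENNReal.tsum_add]
      refine tsum_congr fun j => ?_
      rw [share_add (hr ρ j)]
      cases H (b.shift j) with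
      | none => split_ifs <;> simp
      | some w =>
        simp only [Option.elim_some, ih]
        split_ifs <;> ring

theorem TyAdd.sat {A : Prop} {H : Heap} {n : ℕ} {τ₁ τ₂ τ : Ty n} (h : TyAdd τ₁ τ₂ τ)
    {ρ : Var n → ℤ} {v : Val} (hs : τ.Sat A H ρ v) : τ₁.Sat A H ρ v ∧ τ₂.Sat A H ρ v := by
  induction h generalizing v with
  | int =>
    obtain ⟨c, rfl, hc⟩ := hs
    exact ⟨⟨c, rfl, hc.1⟩, ⟨c, rfl, hc.2⟩⟩
  | @ref n τ₁ τ₂ τ r₁ r₂ r _ hr ih =>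
    have h₁ : ∀ j, (0 : ℚ) ≤ r₁.val ρ j := fun j => (r₁.val ρ j).2.1
    have h₂ : ∀ j, (0 : ℚ) ≤ r₂.val ρ j := fun j => (r₂.val ρ j).2.1
    refine ⟨⟨hs.1, fun b hb j hj => ?_⟩, ⟨hs.1, fun b hb j hj => ?_⟩⟩
    · obtain ⟨w, hw, hs⟩ := hs.2 b hb j (by rw [hr]; linarith [h₂ j])
      exact ⟨w, hw, (ih hs).1⟩
    · obtain ⟨w, hw, hs⟩ := hs.2 b hb j (by rw [hr]; linarith [h₁ j])
      exact ⟨w, hw, (ih hs).2⟩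

theorem TyAdd.sat_of_emptyAt_right {A : Prop} {H : Heap} {n : ℕ} {τ₁ τ₂ τ : Ty n}
    (h : TyAdd τ₁ τ₂ τ) {ρ : Var n → ℤ} {v : Val} (h₁ : τ₁.Sat A H ρ v) (h₂ : τ₂.EmptyAt ρ) :
    τ.Sat A H ρ v := by
  induction h generalizing v with
  | int =>
    obtain ⟨c, rfl, hc⟩ := h₁
    exact ⟨c, rfl, hc, h₂ c⟩
  | ref _ hr ih =>
    refine ⟨h₁.1, fun b hb j hj => ?_⟩
    rw [hr, (h₂ j).1, add_zero] at hj
    obtain ⟨w, hw, hs⟩ := h₁.2 b hb j hj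
    exact ⟨w, hw, ih hs (h₂ j).2⟩

theorem TyAdd.sat_of_emptyAt_left {A : Prop} {H : Heap} {n : ℕ} {τ₁ τ₂ τ : Ty n}
    (h : TyAdd τ₁ τ₂ τ) {ρ : Var n → ℤ} {v : Val} (h₁ : τ₁.EmptyAt ρ) (h₂ : τ₂.Sat A H ρ v) :
    τ.Sat A H ρ v := by
  induction h generalizing v with
  | int =>
    obtain ⟨c, rfl, hc⟩ := h₂
    exact ⟨c, rfl, h₁ c, hc⟩
  | ref _ hr ih =>
    refine ⟨h₂.1, fun b hb j hj => ?_⟩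
    rw [hr, (h₁ j).1, zero_add] at hj
    obtain ⟨w, hw, hs⟩ := h₂.2 b hb j hj
    exact ⟨w, hw, ih (h₁ j).2 hs⟩

/-- Merging two views of one value. A cell owned by both satisfies both element types, by recursion.
At a cell owned by only one side the other side guarantees nothing, and `Proper` makes its element
type empty, so nothing is missing. -/
theorem TyAdd.sat_of_sat {A : Prop} {H : Heap} {n : ℕ} {τ₁ τ₂ τ : Ty n}
    (h : TyAdd τ₁ τ₂ τ) {ρ : Var n → ℤ} {v : Val} (p₁ : τ₁.Proper ρ) (p₂ : τ₂.Proper ρ)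
    (h₁ : τ₁.Sat A H ρ v) (h₂ : τ₂.Sat A H ρ v) : τ.Sat A H ρ v := by
  induction h generalizing v with
  | int =>
    obtain ⟨c, rfl, hc⟩ := h₁
    obtain ⟨c', hc', hd⟩ := h₂
    cases hc'
    exact ⟨c, rfl, hc, hd⟩
  | @ref n τ₁ τ₂ τ r₁ r₂ r ha hr ih =>
    refine ⟨h₁.1, fun b hb j hj => ?_⟩
    rw [hr] at hj
    rcases (r₁.val ρ j).2.1.eq_or_lt with h0 | h1
    · rw [← h0, zero_add] at hj
      obtain ⟨w, hw, hs⟩ := h₂.2 b hb j hj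
      exact ⟨w, hw, ha.sat_of_emptyAt_left ((p₁ j).1 h0.symm) hs⟩
    · obtain ⟨w, hw, hs⟩ := h₁.2 b hb j h1
      refine ⟨w, hw, ?_⟩
      rcases (r₂.val ρ j).2.1.eq_or_lt with h0 | h2
      · exact ha.sat_of_emptyAt_right hs ((p₂ j).1 h0.symm)
      · obtain ⟨w', hw', hs'⟩ := h₂.2 b hb j h2
        rw [hw] at hw'
        cases hw'
        exact ih (p₁ j).2 (p₂ j).2 hs hs'

/-! ### Locality: the heap matters only at owned cells. -/

namespace Ty

variable {A : Prop} {H H' : Heap} {n : ℕ}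

/-- An index without ownership has an empty element type and contributes 0 in either heap. At any
other index the cell itself is owned, so its content is unchanged, and what the content owns is part
of the total, so recursion applies. -/
theorem own_heap {τ : Ty n} {ρ : Var n → ℤ} (hp : τ.Proper ρ) {v : Val}
    (h : ∀ p, own H p τ ρ v ≠ 0 → H' p = H p) (p : Addr) : own H' p τ ρ v = own H p τ ρ v := by
  induction τ generalizing v with
  | int φ => simp
  | ref τ r ih =>
    cases v with
    | int c => simp
    | addr b =>
      simp only [own_ref] at h ⊢
      refine tsum_congr fun j => ?_
      congr 1
      by_cases hj : (r.val ρ j : ℚ) = 0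
      · have he := (hp j).1 hj
        cases H (b.shift j) <;> cases H' (b.shift j) <;> simp [he.own_eq_zero]
      · have hs : share (r.val ρ j) ≠ 0 := fun h0 => by
          have := (r.val ρ j).2.1.lt_of_ne (Ne.symm hj)
          simp only [share, ENNReal.ofReal_eq_zero] at h0
          exact absurd (by exact_mod_cast this) (not_lt.2 h0)
        -- The positive share of this cell is itself a summand of the ownership of its address.
        have hH : H' (b.shift j) = H (b.shift j) := h _ fun h0 => by
          have := ENNReal.tsum_eq_zero.1 h0 j
          simp only [↓reduceIte, add_eq_zero] at this
          exact hs this.1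
        rw [hH]
        cases hw : H (b.shift j) with
        | none => rfl
        | some w =>
          refine ih (hp j).2 fun q hq => h q fun h0 => hq ?_
          have := ENNReal.tsum_eq_zero.1 h0 j
          rw [hw] at this
          exact (add_eq_zero.1 this).2

/-- `Sat` only inspects cells of positive ownership, so properness plays no role here. -/
theorem Sat.heap {τ : Ty n} {ρ : Var n → ℤ} {v : Val}
    (h : ∀ p, own H p τ ρ v ≠ 0 → H' p = H p) (hs : τ.Sat A H ρ v) : τ.Sat A H' ρ v := by
  induction τ generalizing v with
  | int φ => exact hs
  | ref τ r ih =>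
    refine ⟨hs.1, fun b hb j hj => ?_⟩
    subst hb
    obtain ⟨w, hw, hs⟩ := hs.2 b rfl j hj
    simp only [own_ref] at h
    refine ⟨w, ?_, ih (fun q hq => h q fun h0 => hq ?_) hs⟩
    · rw [h, hw]
      intro h0
      have := ENNReal.tsum_eq_zero.1 h0 j
      simp only [↓reduceIte, add_eq_zero, share, ENNReal.ofReal_eq_zero] at this
      exact absurd (by exact_mod_cast hj) (not_lt.2 this.1)
    · have := ENNReal.tsum_eq_zero.1 h0 j
      rw [hw] at this
      exact (add_eq_zero.1 this).2

/-- Owned cells are allocated; this is why fresh arrays cannot overlap anything owned. -/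
theorem Sat.defined {τ : Ty n} {ρ : Var n → ℤ} (hp : τ.Proper ρ) {v : Val}
    (hs : τ.Sat A H ρ v) {p : Addr} (h : own H p τ ρ v ≠ 0) : H p ≠ none := by
  induction τ generalizing v with
  | int φ => simp at h
  | ref τ r ih =>
    cases v with
    | int c => simp at h
    | addr b =>
      rw [own_ref, ne_eq, ENNReal.tsum_eq_zero, not_forall] at h
      obtain ⟨j, hj⟩ := h
      rcases (r.val ρ j).2.1.eq_or_lt with h0 | h1
      · exfalso
        apply hj
        rw [share_eq_zero h0.symm]
        cases H (b.shift j) <;> simp [((hp j).1 h0.symm).own_eq_zero]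
      · obtain ⟨w, hw, hs⟩ := hs.2 b rfl j h1
        rw [hw, Option.elim_some] at hj
        by_cases hpj : p = b.shift j
        · simp [hpj, hw]
        · rw [if_neg hpj, zero_add] at hj
          exact ih (hp j).2 hs hj

theorem share_le_own {b : Addr} {τ : Ty (n + 1)} {r : Ownership n} {ρ : Var n → ℤ} {j : ℤ} :
    share (r.val ρ j) ≤ own H (b.shift j) (.ref τ r) ρ (.addr b) := by
  rw [own_ref]
  refine le_trans ?_ (ENNReal.le_tsum j)
  simp

/-! ### Strengthening, weakening and index shifts in the model. -/

@[simp] theorem own_strengthenEq (p : Addr) (x : ℕ) (τ : Ty n) (ρ : Var n → ℤ) (v : Val) :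
    own H p (τ.strengthenEq x) ρ v = own H p τ ρ v := by
  cases τ <;> simp [strengthenEq]

theorem Sat.strengthenEq {τ : Ty n} {ρ : Var n → ℤ} {v : Val} (hs : τ.Sat A H ρ v) {x : ℕ}
    (hx : ∀ c, v = .int c → ρ (.name x) = c) : (τ.strengthenEq x).Sat A H ρ v := by
  cases τ with
  | int φ =>
    obtain ⟨c, rfl, hc⟩ := hs
    exact ⟨c, rfl, hc, (hx c rfl).symm⟩
  | ref τ r => exact hs

theorem own_weaken (p : Addr) (τ : Ty n) (c : ℤ) (ρ : Var n → ℤ) (v : Val) :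
    own H p τ.weaken (consVal c ρ) v = own H p τ ρ v := by
  rw [weaken, rename, own_subst]
  exact congrArg (fun ρ => own H p τ ρ v) (funext fun x => consVal_succ c ρ x)

theorem sat_weaken (τ : Ty n) (c : ℤ) (ρ : Var n → ℤ) (v : Val) :
    Sat A H τ.weaken (consVal c ρ) v ↔ Sat A H τ ρ v := by
  rw [weaken, rename, sat_subst]
  exact iff_of_eq (congrArg (fun ρ => Sat A H τ ρ v) (funext fun x => consVal_succ c ρ x))

theorem proper_weaken (τ : Ty n) (c : ℤ) (ρ : Var n → ℤ) :
    Proper τ.weaken (consVal c ρ) ↔ Proper τ ρ := by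
  rw [weaken, rename, proper_subst]
  exact iff_of_eq (congrArg (fun ρ => Proper τ ρ) (funext fun x => consVal_succ c ρ x))

theorem own_shiftAdd (p : Addr) (z : ℕ) (τ : Ty 1) (c : ℤ) (ρ : Var 0 → ℤ) (v : Val) :
    own H p (τ.shiftAdd z) (consVal c ρ) v = own H p τ (consVal (c + ρ (.name z)) ρ) v := by
  rw [shiftAdd, own_subst]
  exact congrArg (fun ρ => own H p τ ρ v) (funext fun x => by
    match x with
    | .name x => rfl
    | .idx ⟨0, _⟩ => rfl)

theorem sat_shiftAdd (z : ℕ) (τ : Ty 1) (c : ℤ) (ρ : Var 0 → ℤ) (v : Val) :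
    Sat A H (τ.shiftAdd z) (consVal c ρ) v ↔ Sat A H τ (consVal (c + ρ (.name z)) ρ) v := by
  rw [shiftAdd, sat_subst]
  exact iff_of_eq (congrArg (fun ρ => Sat A H τ ρ v) (funext fun x => by
    match x with
    | .name x => rfl
    | .idx ⟨0, _⟩ => rfl))

theorem own_shiftSub (p : Addr) (z : ℕ) (τ : Ty 1) (c : ℤ) (ρ : Var 0 → ℤ) (v : Val) :
    own H p (τ.shiftSub z) (consVal c ρ) v = own H p τ (consVal (c - ρ (.name z)) ρ) v := by
  rw [shiftSub, own_subst]
  exact congrArg (fun ρ => own H p τ ρ v) (funext fun x => by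
    match x with
    | .name x => rfl
    | .idx ⟨0, _⟩ => rfl)

theorem sat_shiftSub (z : ℕ) (τ : Ty 1) (c : ℤ) (ρ : Var 0 → ℤ) (v : Val) :
    Sat A H (τ.shiftSub z) (consVal c ρ) v ↔ Sat A H τ (consVal (c - ρ (.name z)) ρ) v := by
  rw [shiftSub, sat_subst]
  exact iff_of_eq (congrArg (fun ρ => Sat A H τ ρ v) (funext fun x => by
    match x with
    | .name x => rfl
    | .idx ⟨0, _⟩ => rfl))

theorem emptyAt_shiftSub (z : ℕ) (τ : Ty 1) (c : ℤ) (ρ : Var 0 → ℤ) :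
    EmptyAt (τ.shiftSub z) (consVal c ρ) ↔ EmptyAt τ (consVal (c - ρ (.name z)) ρ) := by
  rw [shiftSub, emptyAt_subst]
  exact iff_of_eq (congrArg (fun ρ => EmptyAt τ ρ) (funext fun x => by
    match x with
    | .name x => rfl
    | .idx ⟨0, _⟩ => rfl))

theorem proper_shiftSub (z : ℕ) (τ : Ty 1) (c : ℤ) (ρ : Var 0 → ℤ) :
    Proper (τ.shiftSub z) (consVal c ρ) ↔ Proper τ (consVal (c - ρ (.name z)) ρ) := by
  rw [shiftSub, proper_subst]
  exact iff_of_eq (congrArg (fun ρ => Proper τ ρ) (funext fun x => by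
    match x with
    | .name x => rfl
    | .idx ⟨0, _⟩ => rfl))

/-- Moving a pointer by `c` cells and its type by `-c` cells. -/
theorem own_ref_shiftSub (p : Addr) {z : ℕ} {τ : Ty 1} {r rz : Ownership 0} {ρ : Var 0 → ℤ}
    (hr : ∀ i : ℤ, rz.val ρ i = r.val ρ (i - ρ (.name z))) (b : Addr) :
    own H p (.ref (τ.shiftSub z) rz) ρ (.addr b) =
      own H p (.ref τ r) ρ (.addr (b.shift (ρ (.name z)))) := by
  rw [own_ref, own_ref, ← (Equiv.addRight (ρ (.name z))).tsum_eq]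
  refine tsum_congr fun j => ?_
  simp only [hr, own_shiftSub, Addr.shift_shift, Equiv.coe_addRight, add_sub_cancel_right,
    add_comm (ρ (.name z)) j]

theorem sat_ref_shiftSub {z : ℕ} {τ : Ty 1} {r rz : Ownership 0} {ρ : Var 0 → ℤ}
    (hr : ∀ i : ℤ, rz.val ρ i = r.val ρ (i - ρ (.name z))) (b : Addr) :
    Sat A H (.ref (τ.shiftSub z) rz) ρ (.addr b) ↔
      Sat A H (.ref τ r) ρ (.addr (b.shift (ρ (.name z)))) := by
  simp only [Sat, hr, sat_shiftSub, Val.addr.injEq, exists_eq', implies_true, true_and,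
    forall_eq', Addr.shift_shift]
  refine ⟨fun h j hj => ?_, fun h j hj => ?_⟩
  · simpa [add_comm] using h (j + ρ (.name z)) (by simpa using hj)
  · simpa using h _ hj

theorem proper_ref_shiftSub {z : ℕ} {τ : Ty 1} {r rz : Ownership 0} {ρ : Var 0 → ℤ}
    (hr : ∀ i : ℤ, rz.val ρ i = r.val ρ (i - ρ (.name z))) (h : Proper (.ref τ r) ρ) :
    Proper (.ref (τ.shiftSub z) rz) ρ := by
  intro j
  rw [hr, emptyAt_shiftSub, proper_shiftSub]
  exact h _

end Ty

/-! ## Renaming of expressions -/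

theorem Var.lift_lift {n m k : ℕ} (f : Var n → Var m) (g : Var m → Var k) (v : Var (n + 1)) :
    Var.lift g (Var.lift f v) = Var.lift (fun x => g (f x)) v := by
  have key : ∀ x : Var m, Var.lift g x.succ = (g x).succ := fun x => by cases x <;> rfl
  match v with
  | .name x => exact key _
  | .idx i =>
    refine Fin.cases rfl (fun j => ?_) i
    exact key _

theorem Dep.rename_rename {U V W α : Type} [DecidableEq V] [DecidableEq W] (f : U → V) (g : V → W)
    (a : Dep U α) : (a.rename f).rename g = a.rename fun x => g (f x) := by
  refine Dep.ext ?_ rfl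
  simp [Dep.rename, Dep.subst, Dep.var, Finset.biUnion_biUnion]

theorem Dep.rename_congr {V W α : Type} [DecidableEq W] {f g : V → W} {a : Dep V α}
    (h : ∀ v ∈ a.fv, f v = g v) : a.rename f = a.rename g := by
  refine Dep.ext (Finset.biUnion_congr rfl fun v hv => by simp only [h v hv]) (funext fun ρ => ?_)
  exact a.congr _ _ fun v hv => by simp only [h v hv]

theorem Exp.rename_rename {n m k : ℕ} (f : Var n → Var m) (g : Var m → Var k) (e : Exp n) :
    (e.rename f).rename g = e.rename fun x => g (f x) := by
  have hl : ∀ {n m k : ℕ} (f : Var n → Var m) (g : Var m → Var k),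
      (fun x => Var.lift g (Var.lift f x)) = Var.lift fun x => g (f x) :=
    fun f g => funext (Var.lift_lift f g)
  induction e generalizing m k <;> simp_all [Exp.rename, Dep.rename_rename]

theorem Exp.rename_congr {n m : ℕ} {f g : Var n → Var m} {e : Exp n} {x : ℕ} (he : e.Fresh x)
    (h : ∀ v, v ≠ .name x → f v = g v) : e.rename f = e.rename g := by
  have hl : ∀ {n m : ℕ} {f g : Var n → Var m}, (∀ v, v ≠ .name x → f v = g v) →
      ∀ v, v ≠ .name x → Var.lift f v = Var.lift g v := by
    intro n m f g h v hv
    match v with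
    | .name y =>
      exact congrArg Var.succ (h (.name y) fun h => hv (by cases h; rfl))
    | .idx i =>
      refine Fin.cases rfl (fun j => ?_) i
      exact congrArg Var.succ (h (.idx j) nofun)
  induction e generalizing m with
  | int c => rfl
  | var y => simp only [Exp.rename, h _ he]
  | letE e₁ e₂ ih₁ ih₂ => simp only [Exp.rename, ih₁ he.1 h, ih₂ he.2 (hl h)]
  | ifnp y e₁ e₂ ih₁ ih₂ => simp only [Exp.rename, h _ he.1, ih₁ he.2.1 h, ih₂ he.2.2 h]
  | mkarray k len e ih => simp only [Exp.rename, ih he (hl h)]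
  | deref y e ih => simp only [Exp.rename, h _ he.1, ih he.2 (hl h)]
  | addPtr y z e ih => simp only [Exp.rename, h _ he.1, h _ he.2.1, ih he.2.2 (hl h)]
  | call f ys e ih =>
    simp only [Exp.rename, ih he.2 (hl h)]
    rw [List.map_congr_left fun v hv => h v fun h => he.1 (h ▸ hv)]
  | assign y z e ih => simp only [Exp.rename, h _ he.1, h _ he.2.1, ih he.2.2 h]
  | aliasDeref y z e ih => simp only [Exp.rename, h _ he.1, h _ he.2.1, ih he.2.2 h]
  | aliasAddPtr y z w e ih =>
    simp only [Exp.rename, h _ he.1, h _ he.2.1, h _ he.2.2.1, ih he.2.2.2 h]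
  | assert φ e ih =>
    simp only [Exp.rename, ih he.2 h]
    rw [Dep.rename_congr fun v hv => h v fun h => he.1 (h ▸ hv)]

theorem Exp.rename_of_eq_self {n : ℕ} {f : Var n → Var n} (h : ∀ v, f v = v) (e : Exp n) :
    e.rename f = e := by
  have hl : ∀ n, Var.lift (fun v : Var n => v) = fun v => v := fun n => by
    funext v
    match v with
    | .name x => rfl
    | .idx i => refine Fin.cases rfl (fun j => rfl) i
  have hd : ∀ {n : ℕ} (φ : Formula n), φ.rename (fun v => v) = φ := fun φ =>
    Dep.ext (by simp [Dep.rename, Dep.subst, Dep.var]) rfl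
  obtain rfl : f = fun v => v := funext h
  clear h
  induction e <;> simp_all [Exp.rename]

/-- A derivation types the body with its own name `x`, while the reduction picks a register `x'`.
Freshness of `x` reconciles the two by recording `x ↦ x'` in the renaming, so the induction
hypothesis applies to the expression that actually runs. -/
theorem Exp.openWith_rename {e : Exp 1} {x : ℕ} (he : e.Fresh x) (θ : ℕ → ℕ) (x' : ℕ) :
    (e.rename (Var.lift (Var.mapName θ))).openWith x' =
      (e.openWith x).rename (Var.mapName (Function.update θ x x')) := by
  rw [openWith, openWith, rename_rename, rename_rename]
  refine rename_congr he fun v hv => ?_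
  match v with
  | .name y =>
    have : y ≠ x := fun h => hv (by rw [h])
    simp [Var.lift, Var.bindName, Var.mapName, Var.succ, this]
  | .idx ⟨0, _⟩ => simp [Var.lift, Var.bindName, Var.mapName]

/-! ## Safety for a number of steps -/

/-- For `n` steps, the configuration does not fail an assertion; under `A` it does not get stuck;
and values satisfy `Post`. -/
def Safe (A : Prop) (P : Set Val) (D : FunDefs) (Post : Regs → Heap → Exp 0 → Prop) :
    ℕ → Regs → Heap → Exp 0 → Prop
  | 0, _, _, _ => True
  | n + 1, R, H, e => (e.IsValue → Post R H e) ∧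
      (¬ e.IsValue → A → ∃ C, Step P D (.run R H e) C) ∧
      ∀ C, Step P D (.run R H e) C → C = .aliasFail ∨
        ∃ R' H' e', C = .run R' H' e' ∧ Safe A P D Post n R' H' e'

variable {A : Prop} {P : Set Val} {D : FunDefs}

theorem Step.not_isValue {R : Regs} {H : Heap} {e : Exp 0} {C : Config}
    (h : Step P D (.run R H e) C) : ¬ e.IsValue := by
  intro hv; cases hv <;> cases h

theorem Safe.mono {Post Post' : Regs → Heap → Exp 0 → Prop}
    (hP : ∀ R H e, Post R H e → Post' R H e) {n : ℕ} {R : Regs} {H : Heap} {e : Exp 0}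
    (h : Safe A P D Post n R H e) : Safe A P D Post' n R H e := by
  induction n generalizing R H e with
  | zero => trivial
  | succ n ih =>
    refine ⟨fun hv => hP _ _ _ (h.1 hv), h.2.1, fun C hC => ?_⟩
    rcases h.2.2 C hC with h | ⟨R', H', e', rfl, h⟩
    · exact .inl h
    · exact .inr ⟨R', H', e', rfl, ih h⟩

theorem Safe.of_value {Post : Regs → Heap → Exp 0 → Prop} {n : ℕ} {R : Regs} {H : Heap} {e : Exp 0}
    (hv : e.IsValue) (h : Post R H e) : Safe A P D Post n R H e := by
  cases n with
  | zero => trivial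
  | succ n => exact ⟨fun _ => h, fun h => absurd hv h, fun C hC => absurd hv hC.not_isValue⟩

/-- Steps of `e₁` lift through the evaluation context. When `e₁` halts, the remaining budget `m` is
handed to the continuation. -/
theorem Safe.letE {Post Post' : Regs → Heap → Exp 0 → Prop} {n : ℕ} {R : Regs} {H : Heap}
    {e₁ : Exp 0} {e₂ : Exp 1} (h : Safe A P D Post n R H e₁)
    (hP : ∀ m ≤ n, ∀ R' H' e, Post R' H' e → e.IsValue → Safe A P D Post' m R' H' (.letE e e₂)) :
    Safe A P D Post' n R H (.letE e₁ e₂) := by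
  induction n generalizing R H e₁ with
  | zero => trivial
  | succ n ih =>
    by_cases hv : e₁.IsValue
    · exact hP _ le_rfl _ _ _ (h.1 hv) hv
    · refine ⟨nofun, fun _ hA => ?_, fun C hC => ?_⟩
      · obtain ⟨C, hC⟩ := h.2.1 hv hA
        cases C with
        | run R' H' e' => exact ⟨_, .context e₂ hC⟩
        | assertFail => exact ⟨_, .contextAssertFail e₂ hC⟩
        | aliasFail => exact ⟨_, .contextAliasFail e₂ hC⟩
      · cases hC with
        | context _ hC =>
          rcases h.2.2 _ hC with h | ⟨R', H', e', he, h⟩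
          · cases h
          · cases he
            exact .inr ⟨_, _, _, rfl, ih h fun m hm => hP m (hm.trans n.le_succ)⟩
        | contextAssertFail _ hC =>
          rcases h.2.2 _ hC with h | ⟨R', H', e', he, h⟩ <;> contradiction
        | contextAliasFail _ hC => exact .inl rfl
        | letInt _ => exact absurd (.int _) hv
        | letVar _ _ => exact absurd (.var _) hv

/-- The value of a halted expression. -/
inductive EvalsTo (R : Regs) : Exp 0 → Val → Prop where
  | int (c : ℤ) : EvalsTo R (.int c) (.int c)
  | var {x : ℕ} {v : Val} : R x = some v → EvalsTo R (.var (.name x)) v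

theorem Safe.letE_value {Post : Regs → Heap → Exp 0 → Prop} {n : ℕ} {R : Regs} {H : Heap}
    {e₁ : Exp 0} {e₂ : Exp 1} {w : Val} (hR : {x | R x ≠ none}.Finite) (h : EvalsTo R e₁ w)
    (hP : ∀ x, R x = none →
      Safe A P D Post n (Function.update R x (some w)) H (e₂.openWith x)) :
    Safe A P D Post (n + 1) R H (.letE e₁ e₂) := by
  obtain ⟨x, hx⟩ := hR.exists_notMem
  have hx : R x = none := by simpa using hx
  refine ⟨nofun, fun _ _ => ?_, fun C hC => ?_⟩
  · cases h with
    | int c => exact ⟨_, .letInt hx⟩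
    | var hy => exact ⟨_, .letVar hy hx⟩
  · cases h with
    | int c =>
      cases hC with
      | letInt hx => exact .inr ⟨_, _, _, rfl, hP _ hx⟩
      | context _ hC => cases hC
      | contextAssertFail _ hC => cases hC
      | contextAliasFail _ hC => cases hC
    | var hy =>
      cases hC with
      | letVar hy' hx =>
        rw [hy] at hy'
        cases hy'
        exact .inr ⟨_, _, _, rfl, hP _ hx⟩
      | context _ hC => cases hC
      | contextAssertFail _ hC => cases hC
      | contextAliasFail _ hC => cases hC

/-! ## Environments -/

theorem WFName.mono {Γ Γ' : Env} (hΓ : ∀ x τ, Γ x = some τ → Γ' x = some τ) {x : ℕ}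
    (h : WFName Γ x) : WFName Γ' x := by
  induction h with
  | intro h _ ih => exact .intro (hΓ _ _ h) ih

theorem WFTy.mono {Γ Γ' : Env} (hΓ : ∀ x τ, Γ x = some τ → Γ' x = some τ) {n : ℕ} {τ : Ty n}
    (h : WFTy Γ τ) : WFTy Γ' τ := by
  induction h with
  | int h => exact .int fun x hx => (h x hx).mono hΓ
  | ref he _ hr ih => exact .ref he ih fun x hx => (hr x hx).mono hΓ

/-- Each type is checked in the environment built before it; monotonicity carries this to the whole
environment. -/
theorem WFEnv.wfTy {Γ : Env} (h : WFEnv Γ) {x : ℕ} {τ : Ty 0} (hx : Γ x = some τ) :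
    WFTy Γ τ := by
  induction h with
  | empty => cases hx
  | @cons Γ y τ' hy _ hτ ih =>
    have hm : ∀ z τ, Γ z = some τ → (Γ.set y τ') z = some τ := fun z τ hz => by
      rw [Env.set, Function.update_of_ne, hz]
      rintro rfl
      simp [hy] at hz
    rw [Env.set, Function.update_apply] at hx
    split_ifs at hx
    · cases hx
      exact hτ.mono hm
    · exact (ih hx).mono hm

/-- `Γ` without `x`. -/
def Env.erase (Γ : Env) (x : ℕ) : Env := Function.update Γ x none

@[simp] theorem Env.set_self (Γ : Env) (x : ℕ) (τ : Ty 0) : Γ.set x τ x = some τ := by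
  simp [Env.set]

theorem Env.set_of_ne (Γ : Env) {x y : ℕ} (h : y ≠ x) (τ : Ty 0) : Γ.set x τ y = Γ y := by
  simp [Env.set, h]

@[simp] theorem Env.erase_self (Γ : Env) (x : ℕ) : Γ.erase x x = none := by
  simp [Env.erase]

theorem Env.erase_of_ne (Γ : Env) {x y : ℕ} (h : y ≠ x) : Γ.erase x y = Γ y := by
  simp [Env.erase, h]

theorem Env.erase_set (Γ : Env) (x : ℕ) (τ : Ty 0) : (Γ.erase x).set x τ = Γ.set x τ := by
  simp [Env.erase, Env.set]

theorem Env.erase_erase_set_set (Γ : Env) {x y : ℕ} (h : x ≠ y) (τ τ' : Ty 0) :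
    (((Γ.erase x).erase y).set x τ).set y τ' = (Γ.set x τ).set y τ' := by
  funext z
  by_cases hy : z = y
  · simp [hy]
  · by_cases hx : z = x
    · subst hx; simp [Env.set_of_ne _ hy]
    · simp [Env.set_of_ne _ hy, Env.set_of_ne _ hx, Env.erase_of_ne _ hy, Env.erase_of_ne _ hx]

/-- The integer held by a value (`0` for an address). -/
def Val.toInt : Val → ℤ
  | .int c => c
  | .addr _ => 0

/-- The valuation given by the values of the names. -/
def valuation (s : ℕ → Val) : Var 0 → ℤ
  | .name x => (s x).toInt
  | .idx _ => 0

theorem valuation_agree {Γ : Env} {x : ℕ} (hx : Γ x = none) (s : ℕ → Val) (w : Val) :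
    Γ.Agree (valuation (Function.update s x w)) (valuation s) := by
  refine ⟨fun y hy => ?_, fun _ => rfl⟩
  have : y ≠ x := by rintro rfl; exact hy hx
  simp [valuation, this]

/-- The meaning of the type does not depend on the value of `x`. -/
structure Ty.IndepOf (τ : Ty 0) (x : ℕ) : Prop where
  own : ∀ H p s w v,
    τ.own H p (valuation (Function.update s x w)) v = τ.own H p (valuation s) v
  sat : ∀ A H s w v,
    τ.Sat A H (valuation (Function.update s x w)) v ↔ τ.Sat A H (valuation s) v
  proper : ∀ s, τ.Proper (valuation s)

theorem WFTy.indepOf {Γ : Env} {τ : Ty 0} (h : WFTy Γ τ) {x : ℕ} (hx : Γ x = none) :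
    τ.IndepOf x :=
  ⟨fun _ p s w => Ty.own_eq_of_agree h (valuation_agree hx s w) p,
    fun _ _ s w => Ty.sat_iff_of_agree h (valuation_agree hx s w), fun _ => h.proper _⟩

/-- The meaning of the types in `Γ` does not depend on the value of `x`. -/
def Env.IndepOf (Γ : Env) (x : ℕ) : Prop := ∀ y τ, Γ y = some τ → τ.IndepOf x

theorem WFEnv.indepOf {Γ : Env} (h : WFEnv Γ) {x : ℕ} (hx : Γ x = none) : Γ.IndepOf x :=
  fun _ _ hy => (h.wfTy hy).indepOf hx

/-- The ownership of `p` carried by all the variables of `Γ` together. -/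
noncomputable def Env.own (Γ : Env) (s : ℕ → Val) (H : Heap) (p : Addr) : ℝ≥0∞ :=
  ∑' x, (Γ x).elim 0 fun τ => τ.own H p (valuation s) (s x)

theorem Env.own_eq_add {Γ : Env} {x : ℕ} {τ : Ty 0} (hx : Γ x = some τ) (s : ℕ → Val) (H : Heap)
    (p : Addr) : Γ.own s H p = τ.own H p (valuation s) (s x) + (Γ.erase x).own s H p := by
  rw [Env.own, ENNReal.tsum_eq_add_tsum_ite x, hx]
  refine congrArg₂ _ rfl (tsum_congr fun y => ?_)
  by_cases h : y = x
  · simp [h]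
  · simp [h, Env.erase_of_ne]

theorem Env.erase_set_of_none {Γ : Env} {x : ℕ} (hx : Γ x = none) (τ : Ty 0) :
    (Γ.set x τ).erase x = Γ := by
  simp only [Env.set, Env.erase, Function.update_idem]
  rw [← hx, Function.update_eq_self]

theorem Env.own_set {Γ : Env} {x : ℕ} (hx : Γ x = none) (τ : Ty 0) (s : ℕ → Val) (H : Heap)
    (p : Addr) : (Γ.set x τ).own s H p = τ.own H p (valuation s) (s x) + Γ.own s H p := by
  rw [Env.own_eq_add (Env.set_self Γ x τ), Env.erase_set_of_none hx]

theorem Env.own_eq_zero {Γ : Env} {s : ℕ → Val} {H : Heap} {p : Addr} (h : Γ.own s H p = 0)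
    {x : ℕ} {τ : Ty 0} (hx : Γ x = some τ) : τ.own H p (valuation s) (s x) = 0 := by
  have := ENNReal.tsum_eq_zero.1 h x
  rwa [hx] at this

/-! ## Configurations that satisfy an environment -/

/-- Registers and heap are finite, and heaps consist of arrays that start at offset `0`. -/
structure Machine (R : Regs) (H : Heap) : Prop where
  regs : {x | R x ≠ none}.Finite
  heap : {p | H p ≠ none}.Finite
  base : ∀ a i, H (a, i) ≠ none → H (a, 0) ≠ none

theorem Machine.update {R : Regs} {H : Heap} (h : Machine R H) (x : ℕ) (v : Val) :
    Machine (Function.update R x (some v)) H := by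
  refine ⟨(h.regs.insert x).subset fun y hy => ?_, h.heap, h.base⟩
  by_cases hyx : y = x
  · exact .inl hyx
  · exact .inr (by simpa [hyx] using hy)

/-- The name `x` of `Γ` stands for the register `θ x`, which holds `s x`; these values satisfy
their types, and together with the frame `F` they own at most one unit of each address. -/
structure Good (A : Prop) (Γ : Env) (θ : ℕ → ℕ) (s : ℕ → Val) (R : Regs) (H : Heap)
    (F : Addr → ℝ≥0∞) : Prop where
  reg : ∀ x τ, Γ x = some τ → R (θ x) = some (s x)
  sat : ∀ x τ, Γ x = some τ → τ.Sat A H (valuation s) (s x)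
  proper : ∀ x τ, Γ x = some τ → τ.Proper (valuation s)
  le : ∀ p, Γ.own s H p + F p ≤ 1
  frame : ∀ p, F p ≠ 0 → H p ≠ none

namespace Good

variable {Γ : Env} {θ : ℕ → ℕ} {s : ℕ → Val} {R : Regs} {H : Heap} {F : Addr → ℝ≥0∞}

theorem mono (h : Good A Γ θ s R H F) {F' : Addr → ℝ≥0∞} (hF : ∀ p, F' p ≤ F p) :
    Good A Γ θ s R H F' :=
  { h with
    le := fun p => (add_le_add le_rfl (hF p)).trans (h.le p)
    frame := fun p hp => h.frame p fun h0 => hp (le_antisymm (h0 ▸ hF p) zero_le) }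

/-- A variable's ownership can be parked in the frame; `Good.set` takes it back. Most rules park the
affected variables, retype them and take them back. -/
theorem erase (h : Good A Γ θ s R H F) {x : ℕ} {τ : Ty 0} (hx : Γ x = some τ) :
    Good A (Γ.erase x) θ s R H (fun p => τ.own H p (valuation s) (s x) + F p) := by
  have hs : ∀ {y τ}, Γ.erase x y = some τ → Γ y = some τ := fun {y τ} hy => by
    rwa [Env.erase_of_ne] at hy
    rintro rfl
    simp at hy
  refine ⟨fun y τ hy => h.reg y τ (hs hy), fun y τ hy => h.sat y τ (hs hy),
    fun y τ hy => h.proper y τ (hs hy), fun p => ?_, fun p hp => ?_⟩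
  · have := h.le p
    rw [Env.own_eq_add hx] at this
    exact le_of_eq_of_le (by ring) this
  · by_cases hF : F p = 0
    · rw [hF, add_zero] at hp
      exact (h.sat x τ hx).defined (h.proper x τ hx) hp
    · exact h.frame p hF

theorem set {x : ℕ} (hx : Γ x = none) {τ : Ty 0}
    (h : Good A Γ θ s R H (fun p => τ.own H p (valuation s) (s x) + F p))
    (hr : R (θ x) = some (s x)) (hs : τ.Sat A H (valuation s) (s x))
    (hp : τ.Proper (valuation s)) : Good A (Γ.set x τ) θ s R H F := by
  have key : ∀ y τ', Γ.set x τ y = some τ' → y = x ∧ τ' = τ ∨ Γ y = some τ' := fun y τ' hy => by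
    by_cases hyx : y = x
    · subst hyx
      rw [Env.set_self] at hy
      cases hy
      exact .inl ⟨rfl, rfl⟩
    · rw [Env.set_of_ne _ hyx] at hy
      exact .inr hy
  refine ⟨fun y τ' hy => ?_, fun y τ' hy => ?_, fun y τ' hy => ?_, fun p => ?_, fun p hp => ?_⟩
  · rcases key y τ' hy with ⟨rfl, rfl⟩ | hy
    exacts [hr, h.reg y τ' hy]
  · rcases key y τ' hy with ⟨rfl, rfl⟩ | hy
    exacts [hs, h.sat y τ' hy]
  · rcases key y τ' hy with ⟨rfl, rfl⟩ | hy
    exacts [hp, h.proper y τ' hy]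
  · rw [Env.own_set hx]
    exact le_of_eq_of_le (by ring) (h.le p)
  · exact h.frame p fun h0 => hp (add_eq_zero.1 h0).2

/-- `G` is the ownership released by the smaller type. It stays in the frame until it is given to a
result or to a new variable. -/
theorem replace (h : Good A Γ θ s R H F) {x : ℕ} {τ τ' : Ty 0} (hx : Γ x = some τ)
    (hs : τ'.Sat A H (valuation s) (s x)) (hp : τ'.Proper (valuation s)) {G : Addr → ℝ≥0∞}
    (ho : ∀ p, τ'.own H p (valuation s) (s x) + G p ≤ τ.own H p (valuation s) (s x)) :
    Good A (Γ.set x τ') θ s R H (fun p => G p + F p) := by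
  rw [← Env.erase_set]
  refine set (Env.erase_self _ _) ((h.erase hx).mono fun p => ?_) (h.reg _ _ hx) hs hp
  rw [← add_assoc]
  exact add_le_add (ho p) le_rfl

/-- Only the joint ownership of the two variables may not grow; each one separately may, as `alias`
requires. -/
theorem replace₂ (h : Good A Γ θ s R H F) {x y : ℕ} (hxy : x ≠ y) {τx τx' τy τy' : Ty 0}
    (hx : Γ x = some τx) (hy : Γ y = some τy)
    (hsx : τx'.Sat A H (valuation s) (s x)) (hpx : τx'.Proper (valuation s))
    (hsy : τy'.Sat A H (valuation s) (s y)) (hpy : τy'.Proper (valuation s))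
    (ho : ∀ p, τx'.own H p (valuation s) (s x) + τy'.own H p (valuation s) (s y) ≤
      τx.own H p (valuation s) (s x) + τy.own H p (valuation s) (s y)) :
    Good A ((Γ.set x τx').set y τy') θ s R H F := by
  rw [← Env.erase_erase_set_set _ hxy]
  have hy' : (Γ.erase x) y = some τy := by rw [Env.erase_of_ne _ hxy.symm, hy]
  refine set (by rw [Env.set_of_ne _ hxy.symm, Env.erase_self])
    (set (by rw [Env.erase_of_ne _ hxy, Env.erase_self]) (((h.erase hx).erase hy').mono
      fun p => ?_) (h.reg _ _ hx) hsx hpx) (h.reg _ _ hy) hsy hpy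
  rw [← add_assoc, ← add_assoc, add_comm (τy.own _ _ _ _)]
  exact add_le_add (ho p) le_rfl

theorem own_heap (h : Good A Γ θ s R H F) {H' : Heap}
    (hH : ∀ p, Γ.own s H p ≠ 0 → H' p = H p) (p : Addr) : Γ.own s H' p = Γ.own s H p := by
  refine tsum_congr fun x => ?_
  cases hx : Γ x with
  | none => rfl
  | some τ => exact Ty.own_heap (h.proper x τ hx) (fun q hq => hH q fun h0 =>
      hq (Env.own_eq_zero h0 hx)) p

/-- Locality for a whole environment. The frame only has to remain allocated, since nothing is
recorded about its contents. -/
theorem heap (h : Good A Γ θ s R H F) {H' : Heap} (hH : ∀ p, Γ.own s H p ≠ 0 → H' p = H p)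
    (hF : ∀ p, F p ≠ 0 → H' p ≠ none) : Good A Γ θ s R H' F :=
  { h with
    sat := fun x τ hx => (h.sat x τ hx).heap fun q hq => hH q fun h0 =>
      hq (Env.own_eq_zero h0 hx)
    le := fun p => by rw [h.own_heap hH]; exact h.le p
    frame := hF }

theorem defined (h : Good A Γ θ s R H F) {p : Addr} (hp : Γ.own s H p ≠ 0) : H p ≠ none := by
  rw [Env.own, ne_eq, ENNReal.tsum_eq_zero, not_forall] at hp
  obtain ⟨x, hx⟩ := hp
  cases hΓ : Γ x with
  | none => simp [hΓ] at hx
  | some τ =>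
    rw [hΓ] at hx
    exact (h.sat x τ hΓ).defined (h.proper x τ hΓ) hx

theorem _root_.PtrOwn.Env.own_update {Γ : Env} {x : ℕ} (hΓ : Γ.IndepOf x) (hx : Γ x = none)
    (s : ℕ → Val) (w : Val) (H : Heap) (p : Addr) :
    Γ.own (Function.update s x w) H p = Γ.own s H p := by
  refine tsum_congr fun y => ?_
  cases hy : Γ y with
  | none => rfl
  | some τ =>
    have : y ≠ x := by rintro rfl; simp [hx] at hy
    simp only [Option.elim_some, Function.update_of_ne this]
    exact (hΓ y τ hy).own _ _ _ _ _

theorem update_iff {x : ℕ} (hΓ : Γ.IndepOf x) (hx : Γ x = none) {x' : ℕ} {w : Val} :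
    Good A Γ (Function.update θ x x') (Function.update s x w) R H F ↔ Good A Γ θ s R H F := by
  have hne : ∀ {y τ}, Γ y = some τ → y ≠ x := fun {y τ} hy => by
    rintro rfl; simp [hx] at hy
  refine ⟨fun h => ⟨fun y τ hy => ?_, fun y τ hy => ?_, fun y τ hy => (hΓ y τ hy).proper _,
    fun p => ?_, h.frame⟩, fun h => ⟨fun y τ hy => ?_, fun y τ hy => ?_,
    fun y τ hy => (hΓ y τ hy).proper _, fun p => ?_, h.frame⟩⟩
  · simpa [hne hy] using h.reg y τ hy
  · have := h.sat y τ hy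
    rwa [(hΓ y τ hy).sat, Function.update_of_ne (hne hy)] at this
  · have := h.le p
    rwa [Env.own_update hΓ hx] at this
  · simpa [hne hy] using h.reg y τ hy
  · have := h.sat y τ hy
    rwa [(hΓ y τ hy).sat, Function.update_of_ne (hne hy)]
  · have := h.le p
    rwa [Env.own_update hΓ hx]

theorem update_regs (h : Good A Γ θ s R H F) {R' : Regs}
    (hR : ∀ x v, R x = some v → R' x = some v) : Good A Γ θ s R' H F :=
  { h with reg := fun x τ hx => hR _ _ (h.reg x τ hx) }

theorem den (h : Good A Γ θ s R H F) : Γ.den (valuation s) := by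
  intro x φ hx
  obtain ⟨c, hc, hφ⟩ := h.sat x _ hx
  simpa [valuation, hc, Val.toInt] using hφ

/-- The subtypings assume the conjunction of the refinements of `Γ`, which holds at the current
valuation by `Good.den`. -/
theorem sub (h : Good A Γ θ s R H F) {Γ' : Env} (hΓ : WFEnv Γ') (hs : SubEnv Γ Γ') :
    Good A Γ' θ s R H F := by
  refine ⟨fun x τ hx => ?_, fun x τ hx => ?_, fun x τ hx => (hΓ.wfTy hx).proper _, fun p => ?_,
    h.frame⟩
  · obtain ⟨τ', hx', -⟩ := hs x τ hx
    exact h.reg x τ' hx'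
  · obtain ⟨τ', hx', hst⟩ := hs x τ hx
    exact hst.sat h.den (h.sat x τ' hx')
  · refine (add_le_add (ENNReal.tsum_le_tsum fun x => ?_) le_rfl).trans (h.le p)
    cases hx : Γ' x with
    | none => simp
    | some τ =>
      obtain ⟨τ', hx', hst⟩ := hs x τ hx
      simp only [hx', Option.elim_some]
      exact hst.own_le h.den p _

end Good

theorem update_of_some {R : Regs} {x : ℕ} (hx : R x = none) (w : Option Val) {y : ℕ} {v : Val}
    (h : R y = some v) : Function.update R x w y = some v := by
  rw [Function.update_of_ne, h]
  rintro rfl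
  simp [hx] at h

/-! ## The semantic typing judgement -/

/-- The result of a halted evaluation that started with the registers `R` and the heap `H`. -/
def Post (A : Prop) (θ : ℕ → ℕ) (s : ℕ → Val) (R : Regs) (H : Heap) (F : Addr → ℝ≥0∞) (τ : Ty 0)
    (Γₒ : Env) (R' : Regs) (H' : Heap) (e : Exp 0) : Prop :=
  ∃ w, EvalsTo R' e w ∧ τ.Sat A H' (valuation s) w ∧
    Good A Γₒ θ s R' H' (fun p => τ.own H' p (valuation s) w + F p) ∧
    (∀ x v, R x = some v → R' x = some v) ∧ (∀ p, F p ≠ 0 → H' p = H p) ∧ Machine R' H'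

/-- The semantic counterpart of the typing judgement, for `n` steps. -/
def Sem (A : Prop) (P : Set Val) (D : FunDefs) (n : ℕ) (Γ : Env) (e : Exp 0) (τ : Ty 0)
    (Γₒ : Env) : Prop :=
  ∀ m ≤ n, ∀ θ s R H F, Machine R H → Good A Γ θ s R H F →
    Safe A P D (Post A θ s R H F τ Γₒ) m R H (e.rename (Var.mapName θ))

variable {θ : ℕ → ℕ} {s : ℕ → Val} {R R₀ : Regs} {H H₀ : Heap}
  {F : Addr → ℝ≥0∞} {Γ Γₒ : Env} {τ : Ty 0} {n m : ℕ}

theorem Post.trans (hR : ∀ x v, R₀ x = some v → R x = some v) (hH : ∀ p, F p ≠ 0 → H p = H₀ p)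
    {R' : Regs} {H' : Heap} {e : Exp 0} (h : Post A θ s R H F τ Γₒ R' H' e) :
    Post A θ s R₀ H₀ F τ Γₒ R' H' e := by
  obtain ⟨w, h₁, h₂, h₃, h₄, h₅, h₆⟩ := h
  exact ⟨w, h₁, h₂, h₃, fun x v hx => h₄ x v (hR x v hx), fun p hp => (h₅ p hp).trans (hH p hp), h₆⟩

/-- The body of a `let`, after the bound variable has been replaced by the new register `x'`. -/
theorem Sem.safe_openWith {x x' : ℕ} {e : Exp 1} {w : Val} {Γ' : Env}
    (h : Sem A P D n Γ' (e.openWith x) τ Γₒ) (he : e.Fresh x) (hx : Γₒ x = none)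
    (hw : WFResult τ Γₒ) (hm : m ≤ n) (hx' : R x' = none)
    (hR : ∀ x v, R₀ x = some v → R x = some v) (hH : ∀ p, F p ≠ 0 → H p = H₀ p)
    (hM : Machine R H)
    (hG : Good A Γ' (Function.update θ x x') (Function.update s x w)
      (Function.update R x' (some w)) H F) :
    Safe A P D (Post A θ s R₀ H₀ F τ Γₒ) m (Function.update R x' (some w)) H
      ((e.rename (Var.lift (Var.mapName θ))).openWith x') := by
  rw [Exp.openWith_rename he]
  refine (h m hm _ _ _ _ _ (hM.update x' w) hG).mono fun R' H' e' hP => ?_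
  refine Post.trans (R := Function.update R x' (some w)) (H := H)
    (fun y v hy => update_of_some hx' _ (hR y v hy)) hH ?_
  obtain ⟨v, h₁, h₂, h₃, h₄⟩ := hP
  -- The body ends with `x` still bound. As `x` is outside `Γₒ`, neither `τ` nor `Γₒ` depends on it,
  -- and the postcondition can be read at the original `s` and `θ`.
  have hi := hw.1.indepOf hx
  refine ⟨v, h₁, (hi.sat _ _ s w v).1 h₂, ?_, h₄⟩
  simp only [hi.own] at h₃
  exact (Good.update_iff (hw.2.indepOf hx) hx).1 h₃

theorem Safe.of_step {Post : Regs → Heap → Exp 0 → Prop} {e : Exp 0} (hv : ¬ e.IsValue)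
    (hp : A → ∃ C, Step P D (.run R H e) C)
    (hs : ∀ k < n, ∀ C, Step P D (.run R H e) C → C = .aliasFail ∨
      ∃ R' H' e', C = .run R' H' e' ∧ Safe A P D Post k R' H' e') : Safe A P D Post n R H e := by
  cases n with
  | zero => trivial
  | succ n => exact ⟨fun h => absurd h hv, fun _ => hp, hs n n.lt_succ_self⟩

/-! ## Changing one cell, splitting and moving pointers -/

/-- The balances `X` and `Y` replace subtraction, which is truncated in `ℝ≥0∞`. -/
theorem tsum_add_eq_of_eq_off_zero {f g : ℤ → ℝ≥0∞} {X Y : ℝ≥0∞} (h0 : f 0 + X = g 0 + Y)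
    (h : ∀ j, j ≠ 0 → f j = g j) : ∑' j, f j + X = ∑' j, g j + Y := by
  rw [ENNReal.tsum_eq_add_tsum_ite (f := f) 0, ENNReal.tsum_eq_add_tsum_ite (f := g) 0,
    add_right_comm, h0, add_right_comm]
  congr 2
  refine tsum_congr fun j => ?_
  split_ifs with hj
  · rfl
  · exact h j hj

namespace Ty

variable {H' : Heap} {p : Addr}

/-- The accounting shared by reading, writing and aliasing: only the contribution of index 0
changes, by a change of its type, of its content or of both. -/
theorem own_ref_change {τ τ' : Ty 1} {r : Ownership 0} {ρ : Var 0 → ℤ} {b : Addr} {w w' : Val}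
    {X Y : ℝ≥0∞} (hw : H b = some w) (hw' : H' b = some w')
    (h0 : own H' p τ' (consVal 0 ρ) w' + X = own H p τ (consVal 0 ρ) w + Y)
    (hne : ∀ j, j ≠ 0 → H' (b.shift j) = H (b.shift j) ∧ ∀ v, H (b.shift j) = some v →
      own H' p τ' (consVal j ρ) v = own H p τ (consVal j ρ) v) :
    own H' p (.ref τ' r) ρ (.addr b) + X = own H p (.ref τ r) ρ (.addr b) + Y := by
  rw [own_ref, own_ref]
  refine tsum_add_eq_of_eq_off_zero ?_ fun j hj => ?_
  · simp only [Addr.shift_zero, hw, hw', Option.elim_some, add_assoc, h0]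
  · rw [(hne j hj).1]
    cases hv : H (b.shift j) with
    | none => rfl
    | some v => simp only [Option.elim_some, (hne j hj).2 v hv]

/-- The share 1 of the cell at `b` already exhausts the bound, so data reachable through the other
cells cannot own `b` again. This excludes owning cycles through a cell that is about to be written.
-/
theorem own_nested_eq_zero {τ : Ty 1} {r : Ownership 0} {ρ : Var 0 → ℤ} {b : Addr}
    (h : own H b (.ref τ r) ρ (.addr b) ≤ 1) (hr : (r.val ρ 0 : ℚ) = 1) {j : ℤ} (hj : j ≠ 0)
    {w : Val} (hw : H (b.shift j) = some w) : own H b τ (consVal j ρ) w = 0 := by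
  rw [own_ref, ENNReal.tsum_eq_add_tsum_ite 0, Addr.shift_zero, if_pos rfl, share_eq_one hr,
    add_assoc] at h
  nth_rewrite 2 [← add_zero (1 : ℝ≥0∞)] at h
  rw [ENNReal.add_le_add_iff_left ENNReal.one_ne_top, nonpos_iff_eq_zero, add_eq_zero,
    ENNReal.tsum_eq_zero] at h
  have := h.2 j
  rw [if_neg hj, hw] at this
  exact (add_eq_zero.1 this).2

theorem own_ref_shiftAdd {τ τ₁ τ₂ : Ty 1} {r r₁ r₂ : Ownership 0} {ρ : Var 0 → ℤ} {z : ℕ}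
    (ha : TyAdd τ₁ τ₂ τ)
    (hr : ∀ i : ℤ, (r₂.val ρ (i - ρ (.name z)) : ℚ) + r₁.val ρ i = r.val ρ i) (b : Addr) :
    own H p (.ref τ₁ r₁) ρ (.addr b) +
      own H p (.ref (τ₂.shiftAdd z) r₂) ρ (.addr (b.shift (ρ (.name z)))) =
      own H p (.ref τ r) ρ (.addr b) := by
  -- Reindexing by `j - z` aligns the cells seen from the moved pointer with those seen from `b`.
  rw [own_ref, own_ref, own_ref, ← (Equiv.subRight (ρ (.name z))).tsum_eq
    (fun j => _ + Option.elim (H ((b.shift (ρ (.name z))).shift j)) _ _), ← ENNReal.tsum_add]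
  refine tsum_congr fun j => ?_
  simp only [Equiv.subRight_apply, Addr.shift_shift, add_sub_cancel, own_shiftAdd, sub_add_cancel]
  rw [share_add ((hr j).symm.trans (add_comm _ _))]
  cases H (b.shift j) with
  | none => split_ifs <;> simp
  | some w =>
    simp only [Option.elim_some, ha.own]
    split_ifs <;> ring

theorem sat_ref_shiftAdd {τ τ₁ τ₂ : Ty 1} {r r₁ r₂ : Ownership 0} {ρ : Var 0 → ℤ} {z : ℕ}
    (ha : TyAdd τ₁ τ₂ τ)
    (hr : ∀ i : ℤ, (r₂.val ρ (i - ρ (.name z)) : ℚ) + r₁.val ρ i = r.val ρ i) {b : Addr}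
    (h : Sat A H (.ref τ r) ρ (.addr b)) : Sat A H (.ref τ₁ r₁) ρ (.addr b) ∧
      Sat A H (.ref (τ₂.shiftAdd z) r₂) ρ (.addr (b.shift (ρ (.name z)))) := by
  refine ⟨⟨h.1, fun b' hb' j hj => ?_⟩, ⟨fun _ => ⟨_, rfl⟩, fun b' hb' j hj => ?_⟩⟩
  · obtain ⟨w, hw, hs⟩ := h.2 b' hb' j (by
      rw [← hr]; linarith [(r₂.val ρ (j - ρ (.name z))).2.1])
    exact ⟨w, hw, (ha.sat hs).1⟩
  · cases hb'
    obtain ⟨w, hw, hs⟩ := h.2 b rfl (j + ρ (.name z)) (by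
      rw [← hr, add_sub_cancel_right]; linarith [(r₁.val ρ (j + ρ (.name z))).2.1])
    refine ⟨w, ?_, ?_⟩
    · rw [Addr.shift_shift, add_comm, hw]
    · rw [sat_shiftAdd]
      exact (ha.sat hs).2

end Ty

/-! ## Soundness of the typing rules -/

theorem HasType.wf {Θ : FunEnv} {Γ Γₒ : Env} {e : Exp 0} {τ : Ty 0} (h : HasType Θ Γ e τ Γₒ) :
    WFJudgement Γ τ Γₒ := by
  cases h <;> assumption

theorem Good.bind (h : Good A Γ θ s R H F) {x : ℕ} (hΓ : Γ.IndepOf x) (hx : Γ x = none) {x' : ℕ}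
    (hx' : R x' = none) (w : Val) :
    Good A Γ (Function.update θ x x') (Function.update s x w) (Function.update R x' (some w)) H F :=
  ((Good.update_iff hΓ hx).2 h).update_regs fun _ _ => update_of_some hx' _

theorem Good.set_bind {x x' : ℕ} {w : Val} (hx : Γ x = none)
    (h : Good A Γ (Function.update θ x x') (Function.update s x w) (Function.update R x' (some w)) H
      (fun p => τ.own H p (valuation (Function.update s x w)) w + F p))
    (hs : τ.Sat A H (valuation (Function.update s x w)) w)
    (hp : τ.Proper (valuation (Function.update s x w))) :
    Good A (Γ.set x τ) (Function.update θ x x') (Function.update s x w)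
      (Function.update R x' (some w)) H F :=
  Good.set hx (by simpa using h) (by simp) (by simpa using hs) hp

theorem ne_of_none_some {Γ : Env} {x y : ℕ} (hx : Γ x = none) (hy : Γ y = some τ) : y ≠ x := by
  rintro rfl
  simp [hx] at hy

theorem sem_int {c : ℤ}
    (hτ : τ = .int (Dep.map₂ (fun a b => a = b) (.var (.idx 0)) (.const c))) :
    Sem A P D n Γ (.int c) τ Γ := by
  subst hτ
  intro m _ θ s R H F hM h
  refine Safe.of_value (.int c) ⟨.int c, .int c, ⟨c, rfl, rfl⟩, ?_, fun _ _ => id,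
    fun _ _ => rfl, hM⟩
  simpa using h

theorem sem_var {x : ℕ} {τ₁ τ₂ : Ty 0} (hx : Γ x = some τ) (ha : TyAdd τ₁ τ₂ τ)
    (hw : WFEnv (Γ.set x τ₂)) : Sem A P D n Γ (.var (.name x)) τ₁ (Γ.set x τ₂) := by
  intro m _ θ s R H F hM h
  have hs := ha.sat (h.sat x τ hx)
  refine Safe.of_value (.var _) ⟨s x, .var (h.reg x τ hx), hs.1, ?_, fun _ _ => id,
    fun _ _ => rfl, hM⟩
  refine h.replace hx hs.2 ((hw.wfTy (Env.set_self _ _ _)).proper _) fun p => ?_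
  rw [ha.own, add_comm]

theorem sem_letE {Γ₁ : Env} {e₁ : Exp 0} {e₂ : Exp 1} {τ₁ : Ty 0} {x : ℕ}
    (h₁ : Sem A P D n Γ e₁ τ₁ Γ₁) (h₂ : Sem A P D n (Γ₁.set x τ₁) (e₂.openWith x) τ Γₒ)
    (hx : Γ₁ x = none) (he : e₂.Fresh x) (hxo : Γₒ x = none) (hw₁ : WFResult τ₁ Γ₁)
    (hw : WFResult τ Γₒ) : Sem A P D n Γ (.letE e₁ e₂) τ Γₒ := by
  intro m hm θ s R H F hM h
  refine Safe.letE (h₁ m hm θ s R H F hM h) fun k hk R' H' v hP _ => ?_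
  obtain ⟨w, hv, hs, hG, hR, hH, hM'⟩ := hP
  cases k with
  | zero => trivial
  | succ k =>
    refine Safe.letE_value hM'.regs hv fun x' hx' => ?_
    refine h₂.safe_openWith he hxo hw ((Nat.le_succ k).trans (hk.trans hm)) hx' hR hH hM' ?_
    have hi := hw₁.1.indepOf hx
    refine Good.set_bind hx ?_ ((hi.sat _ _ s w w).2 hs) (hi.proper _)
    -- The postcondition of `e₁` left the ownership of its value in the frame, which is where
    -- `Good.set_bind` expects it.
    simp only [hi.own]
    exact hG.bind (hw₁.2.indepOf hx) hx hx' w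

theorem sem_ifnp {x : ℕ} {φ : Formula 1} {e₁ e₂ : Exp 0} (hx : Γ x = some (.int φ))
    (h₁ : Sem A P D n (Γ.set x (.int (andNonpos φ))) e₁ τ Γₒ)
    (h₂ : Sem A P D n (Γ.set x (.int (andPos φ))) e₂ τ Γₒ) :
    Sem A P D n Γ (.ifnp (.name x) e₁ e₂) τ Γₒ := by
  intro m hm θ s R H F hM h
  obtain ⟨c, hc, hφ⟩ := h.sat x _ hx
  have hr := h.reg x _ hx
  rw [hc] at hr
  have hG : ∀ ψ, Ty.Sat A H (.int ψ) (valuation s) (s x) → Good A (Γ.set x (.int ψ)) θ s R H F :=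
    fun ψ hψ => (h.replace hx hψ (τ' := .int ψ) trivial (G := fun _ => 0) (by simp)).mono (by simp)
  refine Safe.of_step nofun (fun _ => ?_) fun k hk C hC => .inr ?_
  · rcases le_or_gt c 0 with hc | hc
    · exact ⟨_, .ifTrue hr hc⟩
    · exact ⟨_, .ifFalse hr hc⟩
  · cases hC with
    | ifTrue hr' hc' =>
      rw [hr] at hr'
      cases hr'
      exact ⟨_, _, _, rfl, h₁ k (hk.le.trans hm) _ _ _ _ _ hM (hG _ ⟨c, hc, hφ, hc'⟩)⟩
    | ifFalse hr' hc' =>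
      rw [hr] at hr'
      cases hr'
      exact ⟨_, _, _, rfl, h₂ k (hk.le.trans hm) _ _ _ _ _ hM (hG _ ⟨c, hc, hφ, hc'⟩)⟩

theorem sem_deref {y x : ℕ} {e : Exp 1} {τy τy₂ τ₁ τs : Ty 1} {r : Ownership 0} {τx : Ty 0}
    (hy : Γ y = some (.ref τy r)) (ha : TyAdd τ₁ τx.weaken τs)
    (hs : TyEquiv (fun ρ => ρ (.idx 0) = 0) τs τy)
    (h0 : TyEquiv (fun ρ => ρ (.idx 0) = 0) τy₂ (τ₁.strengthenEq x))
    (h1 : TyEquiv (fun ρ => ρ (.idx 0) ≠ 0) τy₂ τy) (hr : ∀ ρ, 0 < (r.val ρ 0 : ℚ))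
    (hx : Γ x = none) (he : e.Fresh x) (hxo : Γₒ x = none)
    (h : Sem A P D n ((Γ.set y (.ref τy₂ r)).set x τx) (e.openWith x) τ Γₒ)
    (hΓ : WFEnv Γ) (hΓ' : WFEnv ((Γ.set y (.ref τy₂ r)).set x τx)) (hw : WFResult τ Γₒ) :
    Sem A P D n Γ (.deref (.name y) e) τ Γₒ := by
  intro m hm θ s R H F hM hG
  have hyx := ne_of_none_some hx hy
  have hsy := hG.sat y _ hy
  have hry := hG.reg y _ hy
  refine Safe.of_step nofun (fun hA => ?_) fun k hk C hC => .inr ?_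
  · obtain ⟨p, hp⟩ := hsy.1 hA
    obtain ⟨w, hw, -⟩ := hsy.2 p hp 0 (hr _)
    obtain ⟨x', hx'⟩ := hM.regs.exists_notMem
    rw [Addr.shift_zero] at hw
    exact ⟨_, .deref (hp ▸ hry) hw (by simpa using hx')⟩
  · cases hC with
    | @deref _ _ _ _ p v x' hp hv hx' =>
      rw [hp] at hry
      refine ⟨_, _, _, rfl, h.safe_openWith he hxo hw (hk.le.trans hm) hx' (fun _ _ => id)
        (fun _ _ => rfl) hM ?_⟩
      -- The new name gets its value before `y` is retyped, because the strengthened type of the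
      -- cell mentions `x`.
      have hG' := hG.bind (hΓ.indepOf hx) hx hx' v
      set s' := Function.update s x v with hs'
      have hxv : s' x = v := by simp [hs']
      have hsy' : s' y = .addr p := by rw [hs', Function.update_of_ne hyx]; simp_all
      have hsy := hG'.sat y _ hy
      obtain ⟨w, hw', hsw⟩ := hsy.2 p hsy' 0 (hr _)
      rw [Addr.shift_zero, hv] at hw'
      cases hw'
      -- The content of the cell is split: one part stays behind the pointer, the other goes to the
      -- new variable.
      obtain ⟨hs₁, hs₂⟩ := ha.sat (hs.2.sat rfl hsw)
      rw [Ty.sat_weaken] at hs₂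
      have hne : (Γ.set y (.ref τy₂ r)) x = none := by rw [Env.set_of_ne _ hyx.symm, hx]
      refine Good.set_bind hne ?_ hs₂ ((hΓ'.wfTy (Env.set_self _ _ _)).proper _)
      refine hG'.replace (τ' := .ref τy₂ r) hy ⟨hsy.1, fun b hb j hj => ?_⟩ ((hΓ'.wfTy ((Env.set_of_ne _ hyx _).trans
        (Env.set_self _ _ _))).proper _) fun q => ?_
      · obtain ⟨w, hw, hsw⟩ := hsy.2 b hb j hj
        refine ⟨w, hw, ?_⟩
        by_cases hj0 : j = 0
        · subst hj0
          rw [hsy'] at hb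
          cases hb
          rw [Addr.shift_zero, hv] at hw
          cases hw
          refine h0.2.sat rfl (hs₁.strengthenEq fun c hc => ?_)
          simp [valuation, hxv, hc, Val.toInt]
        · exact h1.2.sat hj0 hsw
      · rw [hsy']
        -- The heap is unchanged; what the pointer type loses at index 0 is exactly the ownership of
        -- `x`.
        refine le_of_eq ((Ty.own_ref_change (Y := 0) hv hv ?_ fun j hj => ⟨rfl, fun w _ => ?_⟩).trans
          (add_zero _))
        · rw [h0.own_eq rfl, Ty.own_strengthenEq, add_zero, ← hs.own_eq rfl, ha.own,
            Ty.own_weaken]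
        · exact h1.own_eq hj q w

theorem sem_addPtr {y z x : ℕ} {e : Exp 1} {τy τ₁ τ₂ : Ty 1} {rx ry ry₂ : Ownership 0}
    {φ : Formula 1} (hy : Γ y = some (.ref τy ry)) (ha : TyAdd τ₁ τ₂ τy)
    (hz : Γ z = some (.int φ))
    (hr : ∀ (ρ : Var 0 → ℤ) (i : ℤ),
      (rx.val ρ (i - ρ (.name z)) : ℚ) + ry₂.val ρ i = ry.val ρ i)
    (hx : Γ x = none) (he : e.Fresh x) (hxo : Γₒ x = none)
    (h : Sem A P D n ((Γ.set y (.ref τ₁ ry₂)).set x (.ref (τ₂.shiftAdd z) rx)) (e.openWith x) τ Γₒ)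
    (hΓ : WFEnv Γ) (hΓ' : WFEnv ((Γ.set y (.ref τ₁ ry₂)).set x (.ref (τ₂.shiftAdd z) rx)))
    (hw : WFResult τ Γₒ) : Sem A P D n Γ (.addPtr (.name y) (.name z) e) τ Γₒ := by
  intro m hm θ s R H F hM hG
  have hyx := ne_of_none_some hx hy
  have hzx := ne_of_none_some hx hz
  obtain ⟨c, hc, -⟩ := hG.sat z _ hz
  have hrz := hG.reg z _ hz
  have hry := hG.reg y _ hy
  rw [hc] at hrz
  refine Safe.of_step nofun (fun hA => ?_) fun k hk C hC => .inr ?_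
  · obtain ⟨p, hp⟩ := (hG.sat y _ hy).1 hA
    obtain ⟨x', hx'⟩ := hM.regs.exists_notMem
    rw [hp] at hry
    exact ⟨_, .addPtr hry hrz (by simpa using hx')⟩
  · cases hC with
    | @addPtr _ _ _ _ _ a i c' x' hp hc' hx' =>
      rw [hp] at hry
      rw [hrz] at hc'
      cases hc'
      refine ⟨_, _, _, rfl, h.safe_openWith he hxo hw (hk.le.trans hm) hx' (fun _ _ => id)
        (fun _ _ => rfl) hM ?_⟩
      have hG' := hG.bind (hΓ.indepOf hx) hx hx' (.addr (a, i + c))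
      set s' := Function.update s x (.addr (a, i + c)) with hs'
      have hsy : s' y = .addr (a, i) := by rw [hs', Function.update_of_ne hyx]; simp_all
      have hsz : valuation s' (.name z) = c := by
        simp [valuation, hs', Function.update_of_ne hzx, hc, Val.toInt]
      have hac : (a, i + c) = Addr.shift (a, i) (valuation s' (.name z)) := by
        rw [hsz]; rfl
      have hs := hG'.sat y _ hy
      rw [hsy] at hs
      have hs := Ty.sat_ref_shiftAdd ha (hr (valuation s')) hs
      have hne : (Γ.set y (.ref τ₁ ry₂)) x = none := by rw [Env.set_of_ne _ hyx.symm, hx]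
      refine Good.set_bind hne ?_ (by rw [← hs', hac]; exact hs.2)
        ((hΓ'.wfTy (Env.set_self _ _ _)).proper _)
      refine hG'.replace hy (by rw [hsy]; exact hs.1) ((hΓ'.wfTy ((Env.set_of_ne _ hyx _).trans
        (Env.set_self _ _ _))).proper _) fun q => ?_
      rw [← hs', hsy, hac]
      exact (Ty.own_ref_shiftAdd ha (hr _) _).le

/-- Once the test succeeds, `x` points `z` cells beyond `y`. Shifting the type of `x` back by `z`
makes it a second type of the address held by `y`, so the two can be merged, exchanged for an
equivalent sum and split again. -/
theorem sem_aliasAddPtr {x y z : ℕ} {e : Exp 0} {τx τx₂ τy τy₂ : Ty 1}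
    {rx rx₂ ry ry₂ rxz rxz₂ : Ownership 0} {φ : Formula 1} {τs τs₂ : Ty 0} (hxy : x ≠ y)
    (hx : Γ x = some (.ref τx rx)) (hy : Γ y = some (.ref τy ry)) (hz : Γ z = some (.int φ))
    (hr : ∀ (ρ : Var 0 → ℤ) (i : ℤ), rxz.val ρ i = rx.val ρ (i - ρ (.name z)))
    (hr₂ : ∀ (ρ : Var 0 → ℤ) (i : ℤ), rxz₂.val ρ i = rx₂.val ρ (i - ρ (.name z)))
    (ha : TyAdd (.ref (τx.shiftSub z) rxz) (.ref τy ry) τs)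
    (ha₂ : TyAdd (.ref (τx₂.shiftSub z) rxz₂) (.ref τy₂ ry₂) τs₂)
    (he : TyEquiv (fun _ => True) τs τs₂)
    (h : Sem A P D n ((Γ.set x (.ref τx₂ rx₂)).set y (.ref τy₂ ry₂)) e τ Γₒ)
    (hΓ' : WFEnv ((Γ.set x (.ref τx₂ rx₂)).set y (.ref τy₂ ry₂))) :
    Sem A P D n Γ (.aliasAddPtr (.name x) (.name y) (.name z) e) τ Γₒ := by
  intro m hm θ s R H F hM hG
  obtain ⟨c, hc, -⟩ := hG.sat z _ hz
  have hrx := hG.reg x _ hx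
  have hry := hG.reg y _ hy
  have hrz := hG.reg z _ hz
  rw [hc] at hrz
  refine Safe.of_step nofun (fun hA => ?_) fun k hk C hC => ?_
  · obtain ⟨⟨a, i⟩, hp⟩ := (hG.sat x _ hx).1 hA
    obtain ⟨⟨a', i'⟩, hp'⟩ := (hG.sat y _ hy).1 hA
    rw [hp] at hrx
    rw [hp'] at hry
    by_cases hai : a = a' ∧ i = i' + c
    · obtain ⟨rfl, rfl⟩ := hai
      exact ⟨_, .aliasAddPtr hrx hry hrz⟩
    · exact ⟨_, .aliasAddPtrFail hrx hry hrz (by tauto)⟩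
  · cases hC with
    | aliasAddPtrFail => exact .inl rfl
    | @aliasAddPtr _ _ _ _ _ _ a i c' hx' hy' hz' =>
      rw [hrz] at hz'
      cases hz'
      refine .inr ⟨_, _, _, rfl, h k (hk.le.trans hm) _ _ _ _ _ hM ?_⟩
      have hv : valuation s (.name z) = c := by simp [valuation, hc, Val.toInt]
      have hsx : s x = .addr (Addr.shift (a, i) (valuation s (.name z))) := by
        rw [hrx] at hx'
        rw [hv]
        exact Option.some.inj hx'
      have hsy : s y = .addr (a, i) := by
        rw [hry] at hy'
        exact Option.some.inj hy'
      have hpx := Ty.proper_ref_shiftSub (hr _) (hG.proper x _ hx)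
      have hsxs := hG.sat x _ hx
      have hsys := hG.sat y _ hy
      rw [hsx, ← Ty.sat_ref_shiftSub (hr _)] at hsxs
      rw [hsy] at hsys
      have hs₂ := ha₂.sat (he.1.sat trivial (ha.sat_of_sat hpx (hG.proper y _ hy) hsxs hsys))
      rw [Ty.sat_ref_shiftSub (hr₂ _)] at hs₂
      refine hG.replace₂ hxy hx hy (by rw [hsx]; exact hs₂.1) ((hΓ'.wfTy
        ((Env.set_of_ne _ hxy _).trans (Env.set_self _ _ _))).proper _) (by rw [hsy]; exact hs₂.2)
        ((hΓ'.wfTy (Env.set_self _ _ _)).proper _) fun p => ?_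
      rw [hsx, hsy, ← Ty.own_ref_shiftSub _ (hr _), ← Ty.own_ref_shiftSub _ (hr₂ _), ← ha.own,
        ← ha₂.own, he.own_eq trivial]

/-- The successful test makes `x` and the cell hold the same value, so ownership can move between
the variable and the cell. -/
theorem sem_aliasDeref {x y : ℕ} {e : Exp 0} {τx τx₂ : Ty 1} {τy τy₂ : Ty 2}
    {rx rx₂ r : Ownership 0} {ry ry₂ : Ownership 1} {τs τs₂ : Ty 1} (hxy : x ≠ y)
    (hx : Γ x = some (.ref τx rx)) (hy : Γ y = some (.ref (.ref τy ry) r))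
    (ha : TyAdd (Ty.weaken (.ref τx rx)) (.ref τy ry) τs)
    (ha₂ : TyAdd (Ty.weaken (.ref τx₂ rx₂)) (.ref τy₂ ry₂) τs₂)
    (h0 : TyEquiv (fun ρ => ρ (.idx 0) = 0) τs τs₂)
    (h1 : TyEquiv (fun ρ => ρ (.idx 0) ≠ 0) (.ref τy ry) (.ref τy₂ ry₂))
    (h : Sem A P D n ((Γ.set x (.ref τx₂ rx₂)).set y (.ref (.ref τy₂ ry₂) r)) e τ Γₒ)
    (hΓ' : WFEnv ((Γ.set x (.ref τx₂ rx₂)).set y (.ref (.ref τy₂ ry₂) r))) :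
    Sem A P D n Γ (.aliasDeref (.name x) (.name y) e) τ Γₒ := by
  intro m hm θ s R H F hM hG
  have hrx := hG.reg x _ hx
  have hry := hG.reg y _ hy
  refine Safe.of_step nofun (fun hA => ?_) fun k hk C hC => ?_
  · obtain ⟨p, hp⟩ := (hG.sat y _ hy).1 hA
    rw [hp] at hry
    by_cases hpx : H p = some (s x)
    · exact ⟨_, .aliasDeref hry hrx hpx⟩
    · exact ⟨_, .aliasDerefFail hry hrx hpx⟩
  · cases hC with
    | aliasDerefFail => exact .inl rfl
    | @aliasDeref _ _ _ _ _ p v hy' hx' hv =>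
      refine .inr ⟨_, _, _, rfl, h k (hk.le.trans hm) _ _ _ _ _ hM ?_⟩
      have hsx : s x = v := by
        rw [hrx] at hx'
        exact Option.some.inj hx'
      have hsy : s y = .addr p := by
        rw [hry] at hy'
        exact Option.some.inj hy'
      have hsxs := hG.sat x _ hx
      have hsys := hG.sat y _ hy
      have hpy := hG.proper y _ hy
      rw [hsx, ← Ty.sat_weaken _ 0] at hsxs
      have hss : τs.Sat A H (consVal 0 (valuation s)) v := by
        -- If `y` does not own the cell, nothing is known about its content, but the element type is
        -- then empty and the view through `x` suffices.
        rcases (r.val (valuation s) 0).2.1.eq_or_lt with hr | hr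
        · exact ha.sat_of_emptyAt_right hsxs ((hpy 0).1 hr.symm)
        · obtain ⟨w, hw, hsw⟩ := hsys.2 p hsy 0 hr
          rw [Addr.shift_zero, hv] at hw
          cases hw
          exact ha.sat_of_sat ((Ty.proper_weaken _ _ _).2 (hG.proper x _ hx)) (hpy 0).2 hsxs hsw
      have hs₂ := ha₂.sat (h0.1.sat rfl hss)
      rw [Ty.sat_weaken] at hs₂
      refine hG.replace₂ hxy hx hy (by rw [hsx]; exact hs₂.1) ((hΓ'.wfTy
        ((Env.set_of_ne _ hxy _).trans (Env.set_self _ _ _))).proper _)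
        ⟨hsys.1, fun b hb j hj => ?_⟩ ((hΓ'.wfTy (Env.set_self _ _ _)).proper _) fun q => ?_
      · obtain ⟨w, hw, hsw⟩ := hsys.2 b hb j hj
        refine ⟨w, hw, ?_⟩
        by_cases hj0 : j = 0
        · subst hj0
          rw [hsy] at hb
          cases hb
          rw [Addr.shift_zero, hv] at hw
          cases hw
          exact hs₂.2
        · exact h1.1.sat hj0 hsw
      · rw [hsx, hsy, add_comm, add_comm (Ty.own _ _ _ _ v)]
        refine (Ty.own_ref_change hv hv ?_ fun j hj => ⟨rfl, fun w _ => ?_⟩).le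
        · rw [← Ty.own_weaken q (.ref τx₂ rx₂) 0, ← Ty.own_weaken q (.ref τx rx) 0, add_comm, ← ha₂.own,
            add_comm (Ty.own H q (.ref τy ry) _ _), ← ha.own, h0.own_eq rfl]
        · exact (h1.own_eq hj q w).symm

/-- Full ownership of the written cell leaves none to the other variables, to `y` or to the frame,
so by locality all of them survive the update. -/
theorem sem_assign {x y : ℕ} {e : Exp 0} {τx τx₂ : Ty 1} {r : Ownership 0} {τy τ₁ τ₂ : Ty 0}
    (hxy : x ≠ y) (hx : Γ x = some (.ref τx r)) (hy : Γ y = some τy) (ha : TyAdd τ₁ τ₂ τy)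
    (h0 : TyEquiv (fun ρ => ρ (.idx 0) = 0) τx₂ (τ₂.weaken.strengthenEq y))
    (h1 : TyEquiv (fun ρ => ρ (.idx 0) ≠ 0) τx₂ τx) (hr : ∀ ρ, (r.val ρ 0 : ℚ) = 1)
    (h : Sem A P D n ((Γ.set x (.ref τx₂ r)).set y τ₁) e τ Γₒ)
    (hΓ' : WFEnv ((Γ.set x (.ref τx₂ r)).set y τ₁)) :
    Sem A P D n Γ (.assign (.name x) (.name y) e) τ Γₒ := by
  intro m hm θ s R H F hM hG
  have hrx := hG.reg x _ hx
  have hry := hG.reg y _ hy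
  have hsx := hG.sat x _ hx
  refine Safe.of_step nofun (fun hA => ?_) fun k hk C hC => .inr ?_
  · obtain ⟨p, hp⟩ := hsx.1 hA
    obtain ⟨w, hw, -⟩ := hsx.2 p hp 0 (by rw [hr]; norm_num)
    rw [Addr.shift_zero] at hw
    rw [hp] at hrx
    exact ⟨_, .assign hrx (by simp [hw]) hry⟩
  · cases hC with
    | @assign _ _ _ _ _ p v hx' hp hy' =>
      have hsxp : s x = .addr p := by
        rw [hrx] at hx'
        exact Option.some.inj hx'
      have hsy : s y = v := by
        rw [hry] at hy'
        exact Option.some.inj hy'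
      set H' := Function.update H p (some v) with hH'
      have hne : ∀ q, q ≠ p → H' q = H q := fun q hq => Function.update_of_ne hq _ _
      have hpv : H' p = some v := Function.update_self _ _ _
      have hdef : ∀ q, H q ≠ none → H' q ≠ none := fun q hq => by
        by_cases hqp : q = p
        · rw [hqp, hpv]; simp
        · rwa [hne q hqp]
      have hshift : ∀ j : ℤ, j ≠ 0 → Addr.shift p j ≠ p := fun j hj hp => by
        rw [← Addr.shift_zero p, Addr.shift_shift, Addr.shift_inj] at hp
        exact hj (by simpa using hp)
      have hyx : (Γ.erase x) y = some τy := by rw [Env.erase_of_ne _ hxy.symm, hy]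
      have hGy := (hG.erase hx).erase hyx
      have hx1 : 1 ≤ Ty.own H p (.ref τx r) (valuation s) (s x) := by
        have := Ty.share_le_own (H := H) (b := p) (τ := τx) (r := r) (ρ := valuation s) (j := 0)
        rwa [Addr.shift_zero, share_eq_one (hr _), ← hsxp] at this
      have hle := hGy.le p
      -- Cancelling the share 1 of `x` in the global bound leaves 0 for everything else at `p`.
      have hzero : ((Γ.erase x).erase y).own s H p + τy.own H p (valuation s) (s y) + F p = 0 := by
        have : ((Γ.erase x).erase y).own s H p + τy.own H p (valuation s) (s y) + F p + 1 ≤ 0 + 1 := by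
          refine (add_le_add le_rfl hx1).trans ?_
          rw [zero_add]
          exact le_of_eq_of_le (by ring) hle
        exact nonpos_iff_eq_zero.1 ((ENNReal.add_le_add_iff_right ENNReal.one_ne_top).1 this)
      rw [add_eq_zero, add_eq_zero] at hzero
      obtain ⟨⟨hzΓ, hzy⟩, hzF⟩ := hzero
      have hxle : Ty.own H p (.ref τx r) (valuation s) (s x) ≤ 1 :=
        le_trans (le_add_right le_rfl |>.trans (le_add_left le_rfl) |>.trans (le_add_left le_rfl)) hle
      have hkeep : ∀ {f : Addr → ℝ≥0∞}, f p = 0 → ∀ q, f q ≠ 0 → H' q = H q :=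
        fun hf q hq => hne q fun h => hq (h ▸ hf)
      have hGh := hGy.heap (hkeep hzΓ) fun q hq => hdef q (hGy.frame q hq)
      have hsys := ha.sat ((hG.sat y _ hy).heap (hkeep hzy))
      have hoy := Ty.own_heap (hG.proper y _ hy) (hkeep hzy)
      -- The other cells of the array behind `x` do not lead back to `p` either.
      have hnest : ∀ j, j ≠ 0 → ∀ w, H (p.shift j) = some w →
          ∀ q, Ty.own H q τx (consVal j (valuation s)) w ≠ 0 → H' q = H q := fun j hj w hw =>
        hkeep (Ty.own_nested_eq_zero (by rwa [hsxp] at hxle) (hr _) hj hw)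
      have hsx₂ : Ty.Sat A H' (.ref τx₂ r) (valuation s) (s x) := by
        refine ⟨hsx.1, fun b hb j hj => ?_⟩
        obtain ⟨w, hw, hsw⟩ := hsx.2 b hb j hj
        rw [hsxp] at hb
        cases hb
        by_cases hj0 : j = 0
        · subst hj0
          refine ⟨v, by rw [Addr.shift_zero, hpv], h0.2.sat rfl (Ty.Sat.strengthenEq ?_ fun c hc => ?_)⟩
          · rw [Ty.sat_weaken, ← hsy]
            exact hsys.2
          · simp [valuation, hsy, hc, Val.toInt]
        · exact ⟨w, by rw [hne _ (hshift j hj0), hw],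
            h1.2.sat hj0 (hsw.heap (hnest j hj0 w hw))⟩
      have hox : ∀ q, Ty.own H' q (.ref τx₂ r) (valuation s) (s x) ≤
          Ty.own H q (.ref τx r) (valuation s) (s x) + τ₂.own H' q (valuation s) (s y) := fun q => by
        obtain ⟨w, hw⟩ := Option.ne_none_iff_exists'.1 hp
        rw [hsxp, hsy]
        -- `X` is the ownership of the overwritten content. It is discarded, hence an inequality.
        refine le_of_add_le_left (Ty.own_ref_change (X := Ty.own H q τx (consVal 0 (valuation s)) w)
          hw hpv ?_ fun j hj => ⟨hne _ (hshift j hj), fun u hu => ?_⟩).le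
        · rw [h0.own_eq rfl, Ty.own_strengthenEq, Ty.own_weaken, add_comm]
        · rw [h1.own_eq hj]
          exact Ty.own_heap (hG.proper x _ hx j).2 (hnest j hj u hu) q
      refine ⟨_, _, _, rfl, (h k (hk.le.trans hm) _ _ R H' F ⟨hM.regs, ?_, fun a i hai => ?_⟩ ?_).mono
        fun R' H'' e' => Post.trans (fun _ _ => id) (hkeep hzF)⟩
      · refine (hM.heap.insert p).subset fun q hq => ?_
        by_cases hqp : q = p
        · exact .inl hqp
        · exact .inr (by simpa [hne q hqp] using hq)
      · refine hdef _ ?_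
        by_cases hap : (a, i) = p
        · exact hM.base a i (hap ▸ hp)
        · exact hM.base a i (by rwa [hne _ hap] at hai)
      · rw [← Env.erase_erase_set_set _ hxy]
        refine Good.set (by rw [Env.set_of_ne _ hxy.symm, Env.erase_self])
          (Good.set (by rw [Env.erase_of_ne _ hxy, Env.erase_self]) (hGh.mono fun q => ?_) hrx hsx₂
          ((hΓ'.wfTy ((Env.set_of_ne _ hxy _).trans (Env.set_self _ _ _))).proper _)) hry hsys.1
          ((hΓ'.wfTy (Env.set_self _ _ _)).proper _)
        rw [← hoy, ha.own]
        refine (add_le_add (hox q) le_rfl).trans (le_of_eq ?_)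
        ring

/-! ## Fresh arrays -/

/-- The array's kind ensures integers where an integer type needs them. A pointer type without
ownership only asks for an address, and only under `A`. -/
theorem EmptyTy.sat {n : ℕ} {τ : Ty n} (h : EmptyTy τ) (hA : A → ∀ v ∈ P, ∃ p, v = .addr p)
    {v : Val} (hv : InitVal P τ.kind v) (ρ : Var n → ℤ) : τ.Sat A H ρ v := by
  cases h with
  | int =>
    obtain ⟨c, rfl⟩ := hv
    exact ⟨c, rfl, trivial⟩
  | ref _ hr =>
    refine ⟨fun h => hA h v hv, fun b _ j hj => ?_⟩
    rw [hr] at hj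
    exact absurd hj (lt_irrefl _)

theorem arrayOwnership_pos {len : ℕ} {ρ : Var 0 → ℤ} {j : ℤ}
    (h : (0 : ℚ) < (arrayOwnership len).val ρ j) : 0 ≤ j ∧ j < len := by
  by_contra hj
  simp [arrayOwnership, Dep.const, hj] at h

theorem EmptyTy.own_ref_eq_zero {τ : Ty 1} (h : EmptyTy τ) {r : Ownership 0} {ρ : Var 0 → ℤ}
    {b p : Addr} (hp : ∀ j, p = b.shift j → ¬ (0 : ℚ) < r.val ρ j) :
    Ty.own H p (.ref τ r) ρ (.addr b) = 0 := by
  rw [Ty.own_ref, ENNReal.tsum_eq_zero]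
  intro j
  have h₂ : (if p = b.shift j then share (r.val ρ j) else 0) = 0 := by
    split_ifs with hj
    · by_contra h0
      exact hp j hj (pos_of_share_ne_zero h0)
    · rfl
  rw [h₂, zero_add]
  cases H (b.shift j) with
  | none => rfl
  | some w => exact (h.emptyAt _).own_eq_zero p w

theorem EmptyTy.own_ref_le_one {τ : Ty 1} (h : EmptyTy τ) {r : Ownership 0} {ρ : Var 0 → ℤ}
    {b p : Addr} : Ty.own H p (.ref τ r) ρ (.addr b) ≤ 1 := by
  have h₁ : ∀ j, (H (b.shift j)).elim 0 (fun w => Ty.own H p τ (consVal j ρ) w) = 0 := fun j => by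
    cases H (b.shift j) with
    | none => rfl
    | some w => exact (h.emptyAt _).own_eq_zero p w
  simp only [Ty.own_ref, h₁, add_zero]
  by_cases hp : ∃ j, p = b.shift j
  · obtain ⟨j, rfl⟩ := hp
    rw [tsum_eq_single j fun i hi => if_neg fun h => hi (Addr.shift_inj.1 h).symm, if_pos rfl]
    exact share_le_one _
  · rw [ENNReal.tsum_eq_zero.2 fun j => if_neg fun h => hp ⟨j, h⟩]
    exact zero_le_one

theorem sem_mkarray {k : Kind} {len x : ℕ} {e : Exp 1} {τ₁ : Ty 1}
    (hA : A → P.Nonempty ∧ ∀ v ∈ P, ∃ p, v = .addr p)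
    (h₁ : EmptyTy τ₁) (hk : τ₁.kind = k) (hx : Γ x = none) (he : e.Fresh x) (hxo : Γₒ x = none)
    (h : Sem A P D n (Γ.set x (.ref τ₁ (arrayOwnership len))) (e.openWith x) τ Γₒ)
    (hΓ : WFEnv Γ) (hΓ' : WFEnv (Γ.set x (.ref τ₁ (arrayOwnership len)))) (hw : WFResult τ Γₒ) :
    Sem A P D n Γ (.mkarray k len e) τ Γₒ := by
  intro m hm θ s R H F hM hG
  refine Safe.of_step nofun (fun hA' => ?_) fun i hi C hC => .inr ?_
  · obtain ⟨x', hx'⟩ := hM.regs.exists_notMem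
    obtain ⟨a, ha⟩ := (hM.heap.preimage (f := fun a : ℕ => ((a, 0) : Addr))
      fun a _ b _ h => congrArg Prod.fst h).exists_notMem
    obtain ⟨⟨v, hv⟩, -⟩ := hA hA'
    have hv : ∃ v, InitVal P k v := by
      cases k
      exacts [⟨.int 0, 0, rfl⟩, ⟨v, hv⟩]
    obtain ⟨v, hv⟩ := hv
    exact ⟨_, .mkarray (m := fun _ => v) (a := a) (by simpa using ha) (by simpa using hx')
      fun _ _ _ => hv⟩
  · cases hC with
    | @mkarray _ _ _ _ _ a x' c ha hx' hc =>
      -- The reduction rule only checks offset 0; that heaps contain whole arrays starting there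
      -- makes the entire block new.
      have hnew : ∀ q : Addr, (q.1 = a ∧ 0 ≤ q.2 ∧ q.2 < len) → H q = none := fun q hq => by
        by_contra h
        obtain ⟨a', i⟩ := q
        obtain ⟨rfl, -⟩ := hq
        exact hM.base _ i h ha
      have hkeep : ∀ q, H q ≠ none → H.alloc a len c q = H q := fun q hq =>
        if_neg fun h => hq (hnew q h)
      have hdef : ∀ q, H q ≠ none → H.alloc a len c q ≠ none := fun q hq => by rwa [hkeep q hq]
      have hM' : Machine R (H.alloc a len c) := by
        refine ⟨hM.regs, ?_, fun b i hb => ?_⟩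
        · refine (hM.heap.union ((Set.finite_Ico (0 : ℤ) len).image fun j => ((a, j) : Addr))).subset
            fun q hq => ?_
          by_cases hq' : q.1 = a ∧ 0 ≤ q.2 ∧ q.2 < len
          · exact .inr ⟨q.2, hq'.2, by rw [← hq'.1]⟩
          · exact .inl (by simpa [Heap.alloc, hq'] using hq)
        · by_cases hbi : b = a ∧ 0 ≤ i ∧ i < len
          · have : 0 < len := by exact_mod_cast hbi.2.1.trans_lt hbi.2.2
            simp [Heap.alloc, hbi.1, this]
          · refine hdef _ (hM.base b i ?_)
            simpa [Heap.alloc, hbi] using hb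
      have hGh := hG.heap (fun q hq => hkeep q (hG.defined hq)) fun q hq => hdef q (hG.frame q hq)
      have hG' := hGh.bind (hΓ.indepOf hx) hx hx' (.addr (a, 0))
      have hsat : Ty.Sat A (H.alloc a len c) (.ref τ₁ (arrayOwnership len))
          (valuation (Function.update s x (.addr (a, 0)))) (.addr (a, 0)) := by
        refine ⟨fun _ => ⟨_, rfl⟩, fun b hb j hj => ?_⟩
        cases hb
        have hj := arrayOwnership_pos hj
        refine ⟨c j, ?_, h₁.sat (fun h => (hA h).2) (hk ▸ hc j hj.1 hj.2) _⟩
        simp [Heap.alloc, Addr.shift, hj]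
      have hp := (hΓ'.wfTy (Env.set_self _ _ _)).proper
        (valuation (Function.update s x (.addr (a, 0))))
      refine ⟨_, _, _, rfl, h.safe_openWith he hxo hw (hi.le.trans hm) hx' (fun _ _ => id)
        (fun q hq => hkeep q (hG.frame q hq)) hM' ?_⟩
      refine Good.set_bind hx { hG' with le := fun q => ?_, frame := fun q hq => ?_ } hsat hp
      · by_cases hq : q.1 = a ∧ 0 ≤ q.2 ∧ q.2 < len
        · have hF : F q = 0 := by
            by_contra h
            exact hG.frame q h (hnew q hq)
          have hΓ0 : Γ.own s H q = 0 := by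
            by_contra h
            exact hG.defined h (hnew q hq)
          rw [Env.own_update (hΓ.indepOf hx) hx, hG.own_heap fun q hq => hkeep q (hG.defined hq),
            hΓ0, hF, zero_add, add_zero]
          exact h₁.own_ref_le_one
        · rw [h₁.own_ref_eq_zero, zero_add]
          · exact hG'.le q
          · rintro j rfl hj
            have hj := arrayOwnership_pos hj
            exact hq (by simpa [Addr.shift] using hj)
      · by_cases hF : F q = 0
        · simp only [hF, add_zero] at hq
          exact hsat.defined hp hq
        · exact hdef q (hG.frame q hF)

/-! ## Assertions and subsumption -/

theorem sem_assert {φ : Formula 0} {e : Exp 0} (hφ : ∀ ρ, Γ.den ρ → φ.val ρ) (hw : WFDep Γ φ)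
    (h : Sem A P D n Γ e τ Γₒ) : Sem A P D n Γ (.assert φ e) τ Γₒ := by
  intro m hm θ s R H F hM hG
  have hR : Holds R (φ.rename (Var.mapName θ)) := by
    intro ρ hρ
    show φ.val fun v => ρ (v.mapName θ)
    -- The variables of `φ` have integer types, so their registers hold integers, and every
    -- valuation compatible with the registers agrees there with `valuation s`.
    rw [φ.congr _ (valuation s) fun v hv => ?_]
    · exact hφ _ hG.den
    · cases v with
      | name x =>
        cases hw x hv with
        | intro hx _ =>
          obtain ⟨c, hc, -⟩ := hG.sat x _ hx
          have := hG.reg x _ hx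
          rw [hc] at this
          simpa [valuation, hc, Val.toInt, Var.mapName] using hρ _ _ this
      | idx k => exact k.elim0
  refine Safe.of_step nofun (fun _ => ⟨_, .assert hR⟩) fun k hk C hC => .inr ?_
  cases hC with
  | assert _ => exact ⟨_, _, _, rfl, h k (hk.le.trans hm) _ _ _ _ _ hM hG⟩
  | assertFail h => exact absurd hR h

theorem sem_sub {Γ₁ Γ₂ : Env} {e : Exp 0} {τ₂ : Ty 0} (hs : SubEnv Γ Γ₁)
    (hr : SubResult Γ₂ τ₂ Γₒ τ) (h : Sem A P D n Γ₁ e τ₂ Γ₂) (hΓ₁ : WFEnv Γ₁)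
    (hw₂ : WFResult τ₂ Γ₂) (hw : WFResult τ Γₒ) : Sem A P D n Γ e τ Γₒ := by
  intro m hm θ s R H F hM hG
  refine (h m hm θ s R H F hM (hG.sub hΓ₁ hs)).mono fun R' H' e' hP => ?_
  obtain ⟨w, hv, hsw, hG', hR, hH, hM'⟩ := hP
  obtain ⟨x, hx₂, hxo, hsub⟩ := hr
  have hi₂ := hw₂.1.indepOf hx₂
  have hi := hw.1.indepOf hxo
  -- Subsumption on results treats the result as one more variable. It is bound to an imaginary
  -- register, environment subtyping is applied, and its ownership then returns to the frame.
  obtain ⟨x', hx'⟩ := hM'.regs.exists_notMem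
  have hb := hG'.bind (hw₂.2.indepOf hx₂) hx₂ (by simpa using hx') w
  have hb := Good.set_bind hx₂ (by simpa only [hi₂.own] using hb) ((hi₂.sat _ _ s w w).2 hsw)
    (hi₂.proper _)
  have hb := hb.sub (.cons hxo hw.2 hw.1) hsub
  have hsτ := hb.sat x τ (Env.set_self _ _ _)
  have hb := hb.erase (Env.set_self _ _ _)
  rw [Env.erase_set_of_none hxo, Good.update_iff (hw.2.indepOf hxo) hxo] at hb
  simp only [Function.update_self, hi.own] at hb
  rw [Function.update_self, hi.sat] at hsτ
  -- Everything but the register clause carries over; that clause must refer to the real register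
  -- file.
  refine ⟨w, hv, hsτ, { hb with reg := fun y τ' hy => ?_ }, hR, hH, hM'⟩
  have hyx := ne_of_none_some hxo hy
  obtain ⟨τ'', hy'', -⟩ := hsub y τ' (by rwa [Env.set_of_ne _ hyx])
  rw [Env.set_of_ne _ hyx] at hy''
  exact hG'.reg y _ hy''

/-! ## Function calls -/

theorem lookup_zip_of_nodup {α : Type} {xs : List ℕ} {zs : List α} (hx : xs.Nodup)
    (hl : xs.length = zs.length) :
    List.Forall₂ (fun x z => (xs.zip zs).lookup x = some z) xs zs := by
  induction xs generalizing zs with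
  | nil => cases zs <;> simp_all
  | cons x xs ih =>
    cases zs with
    | nil => simp at hl
    | cons z zs =>
      rw [List.nodup_cons] at hx
      refine .cons (by simp) ?_
      have h := ih hx.2 (by simpa using hl)
      rw [List.forall₂_iff_get] at h ⊢
      refine ⟨h.1, fun i h₁ h₂ => ?_⟩
      have hne : xs.get ⟨i, h₁⟩ ≠ x := fun he => hx.1 (he ▸ List.get_mem _ _)
      rw [List.zip_cons_cons, List.lookup_cons, beq_false_of_ne hne]
      exact h.2 i h₁ h₂

theorem lookup_zip_eq_none {α : Type} {xs : List ℕ} {zs : List α} {x : ℕ} (hx : x ∉ xs) :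
    (xs.zip zs).lookup x = none := by
  rw [List.lookup_eq_none_iff]
  intro q hq
  have := (List.of_mem_zip hq).1
  simp only [bne_iff_ne, ne_eq]
  rintro rfl
  exact hx this

/-- `Γ` without the names in `ys`. -/
def Env.restrict (Γ : Env) (ys : List ℕ) : Env := fun x => if x ∈ ys then none else Γ x

theorem Env.own_eq_sum_add {ys : List ℕ} (hy : ys.Nodup) (Γ : Env) (s : ℕ → Val) (H : Heap)
    (p : Addr) : Γ.own s H p =
      (ys.map fun y => (Γ y).elim 0 fun τ => τ.own H p (valuation s) (s y)).sum +
        (Γ.restrict ys).own s H p := by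
  induction ys with
  | nil =>
    have : Γ.restrict [] = Γ := funext fun x => if_neg List.not_mem_nil
    simp [this]
  | cons y ys ih =>
    rw [List.nodup_cons] at hy
    rw [ih hy.2, List.map_cons, List.sum_cons, add_comm (Option.elim _ _ _), add_assoc]
    congr 1
    have h : (Γ.restrict ys).erase y = Γ.restrict (y :: ys) := by
      funext z
      by_cases hz : z = y
      · simp [hz, Env.restrict]
      · simp [Env.erase_of_ne _ hz, Env.restrict, hz]
    have hr : Γ.restrict ys y = Γ y := if_neg hy.1
    rw [← h]
    cases hΓ : Γ y with
    | none =>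
      rw [hΓ] at hr
      have : (Γ.restrict ys).erase y = Γ.restrict ys := by
        rw [Env.erase, ← hr, Function.update_eq_self]
      simp [this]
    | some τ => exact Env.own_eq_add (hr.trans hΓ) s H p

theorem Env.own_restrict_self {ys : List ℕ} (h : ∀ x ∉ ys, Γ x = none) (p : Addr) :
    (Γ.restrict ys).own s H p = 0 := by
  refine ENNReal.tsum_eq_zero.2 fun x => ?_
  by_cases hx : x ∈ ys
  · simp [Env.restrict, hx]
  · simp [Env.restrict, hx, h x hx]

theorem sum_map_eq_of_forall₂ {α β : Type} {f : α → ℝ≥0∞} {g : β → ℝ≥0∞} {l₁ : List α}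
    {l₂ : List β} (h : List.Forall₂ (fun a b => f a = g b) l₁ l₂) :
    (l₁.map f).sum = (l₂.map g).sum := by
  induction h with
  | nil => rfl
  | cons h _ ih => simp [h, ih]

namespace FunTy

theorem preEnv_eq (F : FunTy) (x : ℕ) :
    F.preEnv x = (F.names.zip (F.params.map Param.pre)).lookup x := by
  rw [preEnv, names, List.zip_map']

theorem postEnv_eq (F : FunTy) (x : ℕ) :
    F.postEnv x = (F.names.zip (F.params.map Param.post)).lookup x := by
  rw [postEnv, names, List.zip_map']

end FunTy

/-- How the environments of caller and callee treat one parameter `q` with argument `y`. -/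
structure ArgSpec (F : FunTy) (ys : List ℕ) (Γ : Env) (q : Param) (y : ℕ) : Prop where
  arg : Γ y = some (F.inst ys q.pre)
  lookup : (F.names.zip ys).lookup q.name = some y
  pre : F.preEnv q.name = some q.pre
  post : F.postEnv q.name = some q.post
  update : F.update ys Γ y = some (F.inst ys q.post)

theorem ArgSpec.subst {F : FunTy} {ys : List ℕ} {q : Param} {y : ℕ} (h : ArgSpec F ys Γ q y) :
    argSubst F.names ys q.name = y := by
  rw [argSubst, h.lookup, Option.getD_some]

theorem argSpec {F : FunTy} {ys : List ℕ} (hF : F.names.Nodup) (hy : ys.Nodup)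
    (hp : F.PreAt ys Γ) : List.Forall₂ (ArgSpec F ys Γ) F.params ys := by
  have hl := List.Forall₂.length_eq hp
  have h₁ := lookup_zip_of_nodup (zs := ys) hF (by simpa [FunTy.names] using hl)
  have h₂ := lookup_zip_of_nodup (zs := F.params) hy hl.symm
  have h₃ := lookup_zip_of_nodup (zs := F.params.map Param.pre) hF (by simp [FunTy.names])
  have h₄ := lookup_zip_of_nodup (zs := F.params.map Param.post) hF (by simp [FunTy.names])
  rw [FunTy.PreAt, List.forall₂_iff_get] at hp
  rw [List.forall₂_iff_get] at h₁ h₂ h₃ h₄ ⊢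
  refine ⟨hl, fun i hi hi' => ?_⟩
  have h₁ := h₁.2 i (by simpa [FunTy.names] using hi) hi'
  have h₂ := h₂.2 i hi' hi
  have h₃ := h₃.2 i (by simpa [FunTy.names] using hi) (by simpa using hi)
  have h₄ := h₄.2 i (by simpa [FunTy.names] using hi) (by simpa using hi)
  have hn : ∀ h, F.names.get ⟨i, h⟩ = (F.params.get ⟨i, hi⟩).name := fun h => by
    simp [FunTy.names]
  rw [hn] at h₁ h₃ h₄
  refine ⟨hp.2 i hi hi', h₁, ?_, ?_, ?_⟩
  · rw [FunTy.preEnv_eq, h₃]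
    simp
  · rw [FunTy.postEnv_eq, h₄]
    simp
  · rw [FunTy.update, h₂]

theorem FunTy.update_of_notMem {F : FunTy} {ys : List ℕ} {x : ℕ} (hx : x ∉ ys) (Γ : Env) :
    F.update ys Γ x = Γ x := by
  rw [FunTy.update, lookup_zip_eq_none hx]

theorem valuation_comp (s : ℕ → Val) (f : ℕ → ℕ) :
    valuation (fun x => s (f x)) = fun v => valuation s (v.mapName f) := by
  funext v
  cases v <;> rfl

theorem FunTy.own_inst (F : FunTy) (ys : List ℕ) (τ : Ty 0) (p : Addr) (v : Val) :
    (F.inst ys τ).own H p (valuation s) v =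
      τ.own H p (valuation fun x => s (argSubst F.names ys x)) v := by
  rw [FunTy.inst, Ty.rename, Ty.own_subst, valuation_comp s (argSubst F.names ys)]
  rfl

theorem FunTy.sat_inst (F : FunTy) (ys : List ℕ) (τ : Ty 0) (v : Val) :
    (F.inst ys τ).Sat A H (valuation s) v ↔
      τ.Sat A H (valuation fun x => s (argSubst F.names ys x)) v := by
  rw [FunTy.inst, Ty.rename, Ty.sat_subst, valuation_comp s (argSubst F.names ys)]
  rfl

theorem FunTy.proper_inst (F : FunTy) (ys : List ℕ) (τ : Ty 0) :
    (F.inst ys τ).Proper (valuation s) ↔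
      τ.Proper (valuation fun x => s (argSubst F.names ys x)) := by
  rw [FunTy.inst, Ty.rename, Ty.proper_subst, valuation_comp s (argSubst F.names ys)]
  rfl

/-- The type is well-formed over the callee's parameters, so its instance depends only on the
arguments, and `x` is not among them. -/
theorem FunTy.indepOf_inst {F : FunTy} {ys : List ℕ} {τ : Ty 0} {Γ' : Env} (h : WFTy Γ' τ) {x : ℕ}
    (hx : ∀ y, Γ' y ≠ none → argSubst F.names ys y ≠ x) : (F.inst ys τ).IndepOf x := by
  have ha : ∀ (s : ℕ → Val) (w : Val), Γ'.Agree
      (valuation fun y => Function.update s x w (argSubst F.names ys y))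
      (valuation fun y => s (argSubst F.names ys y)) := fun s w =>
    ⟨fun y hy => by simp [valuation, hx y hy], fun _ => rfl⟩
  refine ⟨fun H p s w v => ?_, fun A H s w v => ?_, fun s => ?_⟩
  · rw [F.own_inst, F.own_inst, Ty.own_eq_of_agree h (ha s w)]
  · rw [F.sat_inst, F.sat_inst, Ty.sat_iff_of_agree h (ha s w)]
  · rw [F.proper_inst]
    exact h.proper _

theorem exists_of_forall₂_left {α β : Type} {r : α → β → Prop} {l₁ : List α} {l₂ : List β}
    (h : List.Forall₂ r l₁ l₂) {a : α} (ha : a ∈ l₁) : ∃ b ∈ l₂, r a b := by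
  induction h with
  | nil => cases ha
  | cons hr _ ih =>
    rcases List.mem_cons.1 ha with rfl | ha
    · exact ⟨_, List.mem_cons_self, hr⟩
    · obtain ⟨b, hb, hr⟩ := ih ha
      exact ⟨b, List.mem_cons_of_mem _ hb, hr⟩

/-- The caller's ownership is that of the callee's parameters plus that of the untouched variables.
It is applied with the types before the call and with those after it. -/
theorem FunTy.own_eq_add {F : FunTy} {ys : List ℕ} {Γ₀ : Env} (hF : F.names.Nodup)
    (hy : ys.Nodup) (h₀ : ∀ x ∉ F.names, Γ₀ x = none)
    (h : List.Forall₂ (fun (q : Param) y => argSubst F.names ys q.name = y ∧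
      ∃ σ, Γ₀ q.name = some σ ∧ Γ y = some (F.inst ys σ)) F.params ys) (p : Addr) :
    Γ.own s H p =
      Γ₀.own (fun x => s (argSubst F.names ys x)) H p + (Γ.restrict ys).own s H p := by
  rw [Env.own_eq_sum_add hy Γ, Env.own_eq_sum_add hF Γ₀, Env.own_restrict_self h₀, add_zero]
  congr 1
  rw [FunTy.names, List.map_map]
  refine (sum_map_eq_of_forall₂ (h.imp fun q y hq => ?_)).symm
  obtain ⟨hs, σ, h₁, h₂⟩ := hq
  simp only [Function.comp_apply, h₁, h₂, Option.elim_some, F.own_inst]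
  rw [← FunTy.names, hs]

theorem argSubst_map {xs ys : List ℕ} {x y : ℕ} (θ : ℕ → ℕ) (h : (xs.zip ys).lookup x = some y) :
    argSubst xs (ys.map θ) x = θ y := by
  suffices ∀ ys : List ℕ, (xs.zip ys).lookup x = some y →
      (xs.zip (ys.map θ)).lookup x = some (θ y) by rw [argSubst, this ys h, Option.getD_some]
  clear h
  induction xs with
  | nil => simp
  | cons x' xs ih =>
    intro ys h
    cases ys with
    | nil => simp at h
    | cons y' ys =>
      rw [List.zip_cons_cons, List.lookup_cons] at h
      rw [List.map_cons, List.zip_cons_cons, List.lookup_cons]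
      cases hx : x == x' with
      | true => simp_all
      | false => simp_all

/-- The callee runs with the caller's other variables added to the frame. Its postcondition
preserves all framed cells, so these variables keep their types, and the arguments get the parameter
types after the call. -/
theorem sem_call {f x : ℕ} {ys : List ℕ} {e : Exp 1} {T : FunTy} {d : FunDef}
    (hd : D f = some d) (hn : T.names = d.params) (hT : T.WF)
    (hbody : ∀ k < n, Sem A P D k T.preEnv d.body T.ret T.postEnv) (hy : ys.Nodup)
    (hp : T.PreAt ys Γ) (hx : T.update ys Γ x = none) (he : e.Fresh x) (hxo : Γₒ x = none)
    (h : Sem A P D n ((T.update ys Γ).set x (T.inst ys T.ret)) (e.openWith x) τ Γₒ)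
    (hΓ : WFEnv Γ) (hw : WFResult τ Γₒ) : Sem A P D n Γ (.call f (ys.map Var.name) e) τ Γₒ := by
  intro m hm θ s R H F hM hG
  have hl := List.Forall₂.length_eq hp
  have hspec := argSpec hT.1 hy hp
  have hren : (Exp.call f (ys.map Var.name) e).rename (Var.mapName θ) =
      .call f ((ys.map θ).map Var.name) (e.rename (Var.lift (Var.mapName θ))) := by
    simp [Exp.rename, Function.comp_def, Var.mapName]
  rw [hren]
  have hlen : d.params.length = (ys.map θ).length := by
    rw [← hn, List.length_map, ← hl, FunTy.names, List.length_map]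
  refine Safe.of_step nofun (fun _ => ⟨_, .call hd hlen⟩) fun k hk C hC => .inr ?_
  generalize hzs : (ys.map θ).map Var.name = zs at hC
  cases hC with
  | @call _ _ _ d' _ ys' hd' hl' =>
  have hys' := List.map_injective_iff.2 (fun a b h => by cases h; rfl) hzs
  subst hys'
  rw [hd] at hd'
  cases hd'
  have hparam : ∀ q ∈ T.names, ∃ p y, p.name = q ∧ y ∈ ys ∧ ArgSpec T ys Γ p y := fun q hq => by
    obtain ⟨p, hp, rfl⟩ := List.mem_map.1 hq
    obtain ⟨y, hy, h⟩ := exists_of_forall₂_left hspec hp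
    exact ⟨p, y, rfl, hy, h⟩
  have harg : ∀ y ∈ ys, ∃ p, ArgSpec T ys Γ p y := fun y hy => by
    obtain ⟨p, -, h⟩ := exists_of_forall₂_left hspec.flip hy
    exact ⟨p, h⟩
  have hpre : ∀ q, T.preEnv q ≠ none → q ∈ T.names := fun q hq => by
    by_contra h
    exact hq (by rw [T.preEnv_eq, lookup_zip_eq_none h])
  have hpost : ∀ q, T.postEnv q ≠ none → q ∈ T.names := fun q hq => by
    by_contra h
    exact hq (by rw [T.postEnv_eq, lookup_zip_eq_none h])
  have hsome : ∀ y σ, T.update ys Γ y = some σ → ∃ σ', Γ y = some σ' := fun y σ hσ => by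
    by_cases hyy : y ∈ ys
    · obtain ⟨p, hp⟩ := harg y hyy
      exact ⟨_, hp.arg⟩
    · exact ⟨σ, by rwa [T.update_of_notMem hyy] at hσ⟩
  have hrest : ∀ y σ, Γ.restrict ys y = some σ → Γ y = some σ := fun y σ hσ => by
    by_cases hyy : y ∈ ys
    · simp [Env.restrict, hyy] at hσ
    · rwa [Env.restrict, if_neg hyy] at hσ
  have hxys : x ∉ ys := fun hxy => by
    obtain ⟨p, hp⟩ := harg x hxy
    rw [hp.update] at hx
    cases hx
  have hxΓ : Γ x = none := by rwa [T.update_of_notMem hxys] at hx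
  have hsum := T.own_eq_add (s := s) (H := H) hT.1 hy (fun x hx => not_not.1 fun h => hx (hpre x h))
    (hspec.imp fun q y hq => ⟨hq.subst, _, hq.pre, hq.arg⟩)
  -- The callee's view: a parameter has the value of its argument and lives in the argument's
  -- register.
  have hGc : Good A T.preEnv (argSubst d.params (ys.map θ)) (fun x => s (argSubst T.names ys x)) R H
      (fun p => (Γ.restrict ys).own s H p + F p) := by
    refine ⟨fun q σ hq => ?_, fun q σ hq => ?_, fun q σ hq => (hT.2.1.wfTy hq).proper _,
      fun p => ?_, fun p hp => ?_⟩
    · obtain ⟨p, y, rfl, -, hp⟩ := hparam q (hpre q (by simp [hq]))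
      rw [← hn, argSubst_map θ hp.lookup, hp.subst]
      exact hG.reg _ _ hp.arg
    · obtain ⟨p, y, rfl, -, hp⟩ := hparam q (hpre q (by simp [hq]))
      rw [hp.pre] at hq
      cases hq
      rw [hp.subst, ← T.sat_inst]
      exact hG.sat _ _ hp.arg
    · rw [← add_assoc, ← hsum]
      exact hG.le p
    · by_cases hF : F p = 0
      · rw [hF, add_zero] at hp
        refine hG.defined fun h0 => hp ?_
        rw [hsum] at h0
        exact (add_eq_zero.1 h0).2
      · exact hG.frame p hF
  refine ⟨_, _, _, rfl, Safe.letE (hbody k (hk.trans_le hm) k le_rfl _ _ _ _ _ hM hGc)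
    fun i hi R' H' v hP _ => ?_⟩
  obtain ⟨w, hv, hs, hG', hR, hH, hM'⟩ := hP
  cases i with
  | zero => trivial
  | succ i =>
  refine Safe.letE_value hM'.regs hv fun x' hx' => ?_
  have hi' : i ≤ n := (Nat.le_succ i).trans (hi.trans (hk.le.trans hm))
  have hHr : ∀ p, (Γ.restrict ys).own s H p ≠ 0 → H' p = H p := fun p hp =>
    hH p fun h0 => hp (add_eq_zero.1 h0).1
  have hHF : ∀ p, F p ≠ 0 → H' p = H p := fun p hp => hH p fun h0 => hp (add_eq_zero.1 h0).2
  refine h.safe_openWith he hxo hw hi' hx' hR hHF hM' ?_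
  have hargne : ∀ q ∈ T.names, argSubst T.names ys q ≠ x := fun q hq => by
    obtain ⟨p, y, rfl, hy, hp⟩ := hparam q hq
    rw [hp.subst]
    rintro rfl
    exact hxys hy
  have hind : (T.update ys Γ).IndepOf x := fun y σ hσ => by
    by_cases hyy : y ∈ ys
    · obtain ⟨p, hp⟩ := harg y hyy
      rw [hp.update] at hσ
      cases hσ
      exact FunTy.indepOf_inst (hT.2.2.2.wfTy hp.post) fun q hq => hargne q (hpost q hq)
    · rw [T.update_of_notMem hyy] at hσ
      exact (hΓ.wfTy hσ).indepOf hxΓ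
  have hret : (T.inst ys T.ret).IndepOf x :=
    FunTy.indepOf_inst hT.2.2.1 fun q hq => hargne q (hpost q hq)
  refine Good.set_bind hx ?_ ((hret.sat _ _ _ _ _).2 ((T.sat_inst _ _ _).2 hs)) (hret.proper _)
  simp only [hret.own, T.own_inst]
  refine Good.bind ?_ hind hx hx' w
  refine ⟨fun y σ hσ => ?_, fun y σ hσ => ?_, fun y σ hσ => (hind y σ hσ).proper _, fun p => ?_,
    fun p hp => hG'.frame p fun h0 => hp ?_⟩
  · obtain ⟨σ', hσ'⟩ := hsome y σ hσ
    exact hR _ _ (hG.reg y σ' hσ')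
  · by_cases hyy : y ∈ ys
    · obtain ⟨p, hp⟩ := harg y hyy
      rw [hp.update] at hσ
      cases hσ
      have := hG'.sat _ _ hp.post
      rw [hp.subst] at this
      rwa [T.sat_inst]
    · rw [T.update_of_notMem hyy] at hσ
      have hr : Γ.restrict ys y = some σ := by rwa [Env.restrict, if_neg hyy]
      exact (hG.sat y σ hσ).heap fun q hq => hHr q fun h0 => hq (Env.own_eq_zero h0 hr)
  · have hres : (T.update ys Γ).restrict ys = Γ.restrict ys := by
      funext y
      by_cases hyy : y ∈ ys
      · simp [Env.restrict, hyy]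
      · simp [Env.restrict, hyy, T.update_of_notMem hyy]
    -- The untouched variables alone, with zero frame, so that locality compares their ownership
    -- before and after the call.
    have hGr : Good A (Γ.restrict ys) θ s R H fun _ => 0 :=
      ⟨fun y σ hσ => hG.reg y σ (hrest y σ hσ), fun y σ hσ => hG.sat y σ (hrest y σ hσ),
        fun y σ hσ => hG.proper y σ (hrest y σ hσ), fun q => by
          refine le_trans ?_ (hG.le q)
          rw [hsum, add_zero]
          exact le_add_right (le_add_left le_rfl), fun q hq => absurd rfl hq⟩
    rw [T.own_eq_add hT.1 hy (fun x hx => not_not.1 fun h => hx (hpost x h))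
      (hspec.imp fun q y hq => ⟨hq.subst, _, hq.post, hq.update⟩), hres, hGr.own_heap hHr]
    exact le_of_eq_of_le (by ring) (hG'.le p)
  · obtain ⟨h1, h2⟩ := add_eq_zero.1 h0
    rw [h1, (add_eq_zero.1 h2).2, add_zero]

/-! ## Soundness -/

/-- The outer induction provides function bodies at all smaller step bounds, which suffices because
entering a body uses a step. The inner induction follows the derivation. -/
theorem HasType.sem {Θ : FunEnv} (hA : A → P.Nonempty ∧ ∀ v ∈ P, ∃ p, v = .addr p)
    (hD : FunsTyped Θ D) (hΘ : ∀ f F, Θ f = some F → F.WF) (n : ℕ) {Γ Γₒ : Env} {e : Exp 0}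
    {τ : Ty 0} (h : HasType Θ Γ e τ Γₒ) : Sem A P D n Γ e τ Γₒ := by
  induction n using Nat.strong_induction_on generalizing Γ Γₒ e τ with
  | _ n IH =>
  induction h with
  | int hτ _ => exact sem_int hτ
  | var hx ha hw => exact sem_var hx ha hw.2.2
  | letE x h₁ hx he hxo _ hw ih₁ ih₂ => exact sem_letE ih₁ ih₂ hx he hxo h₁.wf.2 hw.2
  | ifnp hx _ _ _ ih₁ ih₂ => exact sem_ifnp hx ih₁ ih₂
  | mkarray x h₁ hk hx he hxo h hw ih =>
    exact sem_mkarray hA h₁ hk hx he hxo ih hw.1 h.wf.1 hw.2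
  | deref x hy ha hs h0 h1 hr hx he hxo h hw ih =>
    exact sem_deref hy ha hs h0 h1 hr hx he hxo ih hw.1 h.wf.1 hw.2
  | assign hxy hx hy ha h0 h1 hr h _ ih => exact sem_assign hxy hx hy ha h0 h1 hr ih h.wf.1
  | addPtr x _ hy ha hz hr hx he hxo h hw ih =>
    exact sem_addPtr hy ha hz hr hx he hxo ih hw.1 h.wf.1 hw.2
  | @call Γ Γₒ f ys e F τ x hf hys hp hx he hxo _ hw ih =>
    obtain ⟨d, hd⟩ := Option.ne_none_iff_exists'.1 fun h0 => by
      rw [hD.1 f, hf] at h0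
      cases h0
    obtain ⟨hn, hb⟩ := hD.2 f d F hd hf
    exact sem_call hd hn (hΘ f F hf) (fun k hk => IH k hk hb) hys hp hx he hxo ih hw.1 hw.2
  | aliasDeref hxy hx hy ha ha₂ h0 h1 h _ ih =>
    exact sem_aliasDeref hxy hx hy ha ha₂ h0 h1 ih h.wf.1
  | aliasAddPtr hxy _ _ hx hy hz hr hr₂ ha ha₂ he h _ ih =>
    exact sem_aliasAddPtr hxy hx hy hz hr hr₂ ha ha₂ he ih h.wf.1
  | assert hφ hw _ _ ih => exact sem_assert hφ hw ih
  | sub hs hr h hw ih => exact sem_sub hs hr ih h.wf.1 h.wf.2 hw.2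

theorem good_empty {θ : ℕ → ℕ} {s : ℕ → Val} :
    Good A Env.empty θ s (fun _ => none) (fun _ => none) fun _ => 0 := by
  refine ⟨nofun, nofun, nofun, fun p => ?_, fun p hp => absurd rfl hp⟩
  simp [Env.own, Env.empty]

theorem ProgTyped.reaches {e : Exp 0} (h : ProgTyped D e)
    (hA : A → P.Nonempty ∧ ∀ v ∈ P, ∃ p, v = .addr p) {C : Config} (hC : Reaches P D e C) :
    C = .aliasFail ∨ ∃ R H e', C = .run R H e' ∧
      ∃ Post : Regs → Heap → Exp 0 → Prop, ∀ n, Safe A P D Post n R H e' := by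
  obtain ⟨Θ, τ, Γ, hD, hΘ, ht⟩ := h
  induction hC with
  | refl =>
    refine .inr ⟨_, _, _, rfl, Post A id (fun _ => .int 0) (fun _ => none) (fun _ => none)
      (fun _ => 0) τ Γ, fun n => ?_⟩
    have hM : Machine (fun _ => none) fun _ => none := ⟨by simp, by simp, by simp⟩
    -- The initial state owns nothing; names stand for themselves, and their values are irrelevant
    -- in the empty environment.
    have := ht.sem hA hD hΘ n n le_rfl id _ _ _ _ hM (good_empty (s := fun _ => .int 0))
    rwa [Exp.rename_of_eq_self fun v => by cases v <;> rfl] at this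
  | tail _ hC ih =>
    rcases ih with rfl | ⟨R, H, e', rfl, Post, hs⟩
    · cases hC
    · rcases (hs 1).2.2 _ hC with h | ⟨R', H', e'', rfl, -⟩
      · exact .inl h
      · refine .inr ⟨_, _, _, rfl, Post, fun n => ?_⟩
        -- Safety for every bound survives a step: bound `n` afterwards comes from bound `n + 1`
        -- before.
        rcases (hs (n + 1)).2.2 _ hC with h | ⟨_, _, _, h, hs⟩
        · cases h
        · cases h
          exact hs

end PtrOwn

theorem mainTheorem1 (D : PtrOwn.FunDefs) (e : PtrOwn.Exp 0) (h : PtrOwn.ProgTyped D e) :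
    (∀ P : Set PtrOwn.Val, ¬ PtrOwn.Reaches P D e .assertFail) ∧
    (∀ P : Set PtrOwn.Val, P.Nonempty → (∀ v ∈ P, ∃ p : PtrOwn.Addr, v = .addr p) →
      ∀ C : PtrOwn.Config, PtrOwn.Reaches P D e C →
        C = .aliasFail ∨
        (∃ R H v, PtrOwn.Exp.IsValue v ∧ C = .run R H v) ∨
        (∃ C₁, PtrOwn.Step P D C C₁)) := by
  refine ⟨fun P hC => ?_, fun P hne hP C hC => ?_⟩
  · rcases h.reaches (A := False) nofun hC with h | ⟨_, _, _, h, -⟩ <;> cases h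
  · rcases h.reaches (A := True) (fun _ => ⟨hne, hP⟩) hC with h | ⟨R, H, e', rfl, Post, hs⟩
    · exact .inl h
    · by_cases hv : e'.IsValue
      · exact .inr (.inl ⟨R, H, e', hv, rfl⟩)
      · exact .inr (.inr ((hs 1).2.1 hv trivial))
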